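/- **Conventions.** Let $\xi=e^{2\pi i/3}$, let $L\subset\mathbb C^2$ be the lattice generated by $(1,0),(\xi,0),(0,1),(0,\xi)$, and let $T=\mathbb C^2/L$ with the $\mathbb Z_3$-action generated by $(z_1,z_2)\mapsto(\xi z_1,\xi^{-1}z_2)$. Its nine fixed points are $F_t=[(t_1\frac{\xi+2}{3},\,t_2\frac{\xi+2}{3})]$, $t=(t_1,t_2)\in\mathbb F_3^2$. Let $X$ be the minimal resolution of $T/\mathbb Z_3$ (the $\mathbb Z_3$-orbifold K3 surface). Near $F_t$, with coordinates $z$ centred at $F_t$, it is the blow-up at the origin of $\{x_0^3=x_1x_2\}\subset\mathbb C^3$, where $x=(z_1z_2,z_1^3,z_2^3)$; the exceptional divisor has the two components $C_t^{(1)}=\{u_2=0\}$ and $C_t^{(2)}=\{u_1=0\}$ in $\{u\in\mathbb P^2: u_1u_2=0\}$. A *symmetry* of $X$ is a biholomorphic map $X\to X$ which leaves invariant the holomorphic volume form and the (degenerate) Kähler form induced by $dz_1\wedge dz_2$ and by the Euclidean metric on $T$. Let $N$ be the Niemeier lattice of type $A_2^{12}$, with simple roots $\widetilde E_j^{(\ell)}$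 ($1\le j\le12$, $\ell=1,2$; $\langle\widetilde E_j^{(\ell)},\widetilde E_j^{(\ell)}\rangle=2$, $\langle\widetilde E_j^{(1)},\widetilde E_j^{(2)}\rangle=-1$, other products $0$), generated by these roots and the vectors $\frac13\sum_j a_{ij}(\widetilde E_j^{(1)}+2\widetilde E_j^{(2)})$, where $(a_{ij})$ has the rows $$\begin{array}{c}(0,1,1,1,1,1,1,0,0,0,0,0)\\(-1,0,1,-1,-1,1,0,1,0,0,0,0)\\(-1,1,0,1,-1,-1,0,0,1,0,0,0)\\(-1,-1,1,0,1,-1,0,0,0,1,0,0)\\(-1,-1,-1,1,0,1,0,0,0,0,1,0)\\(-1,1,-1,-1,1,0,0,0,0,0,0,1).\end{array}$$ The classes $E_t^{(\ell)}$ of the curves $C_t^{(\ell)}$ are embedded by $\iota$: $E_{00},E_{01},E_{02},E_{20},E_{21},E_{22}\mapsto\widetilde E_6,\widetilde E_4,\widetilde E_7,\widetilde E_8,\widetilde E_1,\widetilde E_9$ and $E_{10},E_{11},E_{12}\mapsto-\widetilde E_5,-\widetilde E_3,-\widetilde E_2$ (with the same upper index $(\ell)$ on both sides). Let $M_{24}\subset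 S_{24}$ be the group of permutations of the entries that preserve the extended binary Golay code spanned over $\mathbb F_2$ by the words with the following supports: $$\begin{array}{ll} \{1,2,3,5,12,16,18,22\}, & \{3,4,6,9,15,17,21,22\},\\ \{4,7,8,10,12,15,16,19\}, & \{7,8,11,15,16,17,18,23\},\\ \{1,2,4,7,8,16,18,21\}, & \{1,5,8,13,14,16,18,23\},\\ \{10,11,12,13,14,17,20,22\}, & \{3,8,9,11,13,18,19,23\},\\ \{2,5,9,10,14,19,21,24\}, & \{1,4,7,8,9,13,15,16,18,19,22,23\},\\ \{1,2,3,7,8,10,11,13,16,18,22,23\}, & \{1,2,5,7,8,9,10,12,15,16,18,23\}. \end{array}$$ Let $\vartheta$ be the map from the symmetry group of $X$ to $M_{24}$ obtained as follows. For a symmetry $f$ of $X$, extend its action $f_*$ on the classes $E_t^{(\ell)}$ to an automorphism $\Phi$ of $N$ with $\Phi\circ\iota=\iota\circ f_*$; let $\pi\in M_{12}\subset S_{12}$ be the permutation which $\Phi$ induces on the twelve $A_2$-components of the root lattice of $N$; and let $\vartheta(f)\in M_{24}$ be the element which acts on the dodecad $\{d_1,\dots,d_{12}\}$, $(d_1,\dots,d_{12})=(12,8,18,13,2,16,3,23,1,6,4,9)$,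 by $d_i\mapsto d_{\pi(i)}$. **Theorem.** Let $G\subset M_{24}$ be the stabilizer of the octad $\{3,5,6,9,15,19,23,24\}$ (this is the combined symmetry group of all Kummer K3 surfaces). Then $G$ is of type $(\mathbb Z_2)^4\rtimes A_8$, and $G$ together with the image of the symmetry group of $X$ under $\vartheta$ generates $M_{24}$. -/

import Mathlib

open scoped Topology

namespace Z3OrbifoldK3

noncomputable section

/-! ### The complex torus and its quotient by `ℤ₃` -/

/-- The primitive third root of unity `ξ = exp(2πi/3)`. -/
def xi : ℂ := Complex.exp (2 * Real.pi * Complex.I / 3)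

theorem xi_pow_three : xi ^ 3 = 1 := by
  rw [xi, ← Complex.exp_nat_mul]
  convert Complex.exp_two_pi_mul_I using 2
  push_cast
  ring

theorem xi_ne_zero : xi ≠ 0 := Complex.exp_ne_zero _

theorem xi_ne_one : xi ≠ 1 := by
  intro h
  rw [xi, Complex.exp_eq_one_iff] at h
  obtain ⟨n, hn⟩ := h
  have h2 : (2 * Real.pi * Complex.I : ℂ) ≠ 0 := Complex.two_pi_I_ne_zero
  have h3 : (1 : ℂ) = 3 * n := by
    have h4 : (2 * Real.pi * Complex.I : ℂ) * 1 = (2 * Real.pi * Complex.I) * (3 * n) := by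
      linear_combination 3 * hn
    exact mul_left_cancel₀ h2 h4
  have h5 : (1 : ℤ) = 3 * n := by exact_mod_cast h3
  omega

theorem xi_sq : xi ^ 2 = -1 - xi := by
  have h : (xi - 1) * (xi ^ 2 + xi + 1) = 0 := by linear_combination xi_pow_three
  rcases mul_eq_zero.mp h with h | h
  · exact absurd (sub_eq_zero.mp h) xi_ne_one
  · linear_combination h

theorem xi_inv : xi⁻¹ = -1 - xi := by
  apply inv_eq_of_mul_eq_one_right
  linear_combination -xi_sq

/-- The lattice `L ⊂ ℂ²` generated by `(1,0)`, `(ξ,0)`, `(0,1)`, `(0,ξ)`. -/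
def torusLattice : AddSubgroup (ℂ × ℂ) :=
  AddSubgroup.closure {(1, 0), (xi, 0), (0, 1), (0, xi)}

/-- The complex torus `T = ℂ² / L`. -/
abbrev Torus : Type := (ℂ × ℂ) ⧸ torusLattice

/-- The linear map `(z₁, z₂) ↦ (ξ z₁, ξ⁻¹ z₂)` of `ℂ²`. -/
def rotC2 : (ℂ × ℂ) ≃+ (ℂ × ℂ) :=
  (DistribMulAction.toAddEquiv ℂ (Units.mk0 xi xi_ne_zero)).prodCongr
    (DistribMulAction.toAddEquiv ℂ (Units.mk0 xi xi_ne_zero)⁻¹)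

theorem rotC2_apply (z : ℂ × ℂ) : rotC2 z = (xi * z.1, xi⁻¹ * z.2) := rfl

theorem rotC2_map_torusLattice : torusLattice.map rotC2.toAddMonoidHom = torusLattice := by
  have h1 : ((1 : ℂ), (0 : ℂ)) ∈ torusLattice := AddSubgroup.subset_closure (by simp)
  have h2 : (xi, (0 : ℂ)) ∈ torusLattice := AddSubgroup.subset_closure (by simp)
  have h3 : ((0 : ℂ), (1 : ℂ)) ∈ torusLattice := AddSubgroup.subset_closure (by simp)
  have h4 : ((0 : ℂ), xi) ∈ torusLattice := AddSubgroup.subset_closure (by simp)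
  have hx : xi * xi = -1 - xi := by rw [← sq, xi_sq]
  have hx0 := xi_ne_zero
  apply le_antisymm
  · rw [torusLattice, AddMonoidHom.map_closure, AddSubgroup.closure_le, ← torusLattice]
    rintro _ ⟨z, hz, rfl⟩
    rcases hz with rfl | rfl | rfl | rfl
    · simpa [rotC2_apply] using h2
    · have := torusLattice.sub_mem (torusLattice.neg_mem h1) h2
      simpa [rotC2_apply, hx] using this
    · have := torusLattice.sub_mem (torusLattice.neg_mem h3) h4
      simpa [rotC2_apply, xi_inv] using this
    · simpa [rotC2_apply, hx0] using h3
  · rw [torusLattice, AddSubgroup.closure_le, ← torusLattice]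
    rintro z (rfl | rfl | rfl | rfl)
    · refine ⟨_, torusLattice.sub_mem (torusLattice.neg_mem h1) h2, ?_⟩
      have : xi * (-1 - xi) = 1 := by linear_combination -hx
      simp [rotC2_apply, this]
    · exact ⟨_, h1, by simp [rotC2_apply]⟩
    · exact ⟨_, h4, by simp [rotC2_apply, hx0]⟩
    · refine ⟨_, torusLattice.sub_mem (torusLattice.neg_mem h3) h4, ?_⟩
      have : (-1 - xi) * (-1 - xi) = xi := by linear_combination hx
      simp [rotC2_apply, xi_inv, this]

/-- The generator of the `ℤ₃`-action on `T`, induced by `(z₁, z₂) ↦ (ξ z₁, ξ⁻¹ z₂)`. -/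
def rotTorus : Equiv.Perm Torus :=
  (QuotientAddGroup.congr torusLattice torusLattice rotC2 rotC2_map_torusLattice).toEquiv

/-- The quotient `T / ℤ₃`, whose points are the orbits of the cyclic group generated
by `rotTorus`. -/
abbrev TorusModZ3 : Type := Quotient (Equiv.Perm.SameCycle.setoid rotTorus)

/-- The class in `T / ℤ₃` of a point of `ℂ²`. -/
def proj (z : ℂ × ℂ) : TorusModZ3 :=
  Quotient.mk (Equiv.Perm.SameCycle.setoid rotTorus) (z : Torus)

/-- The singular points of `T / ℤ₃` are the images of the `ℤ₃`-fixed points of `T`. -/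
def IsSingular (p : TorusModZ3) : Prop :=
  ∃ q : Torus, rotTorus q = q ∧
    p = Quotient.mk (Equiv.Perm.SameCycle.setoid rotTorus) q

/-- Labels of the nine fixed points: the affine plane over `𝔽₃`. -/
abbrev Label : Type := ZMod 3 × ZMod 3

/-- The representative `(t₁ (ξ+2)/3, t₂ (ξ+2)/3)` in `ℂ²` of the fixed point labelled by `t`. -/
def fixedPt (t : Label) : ℂ × ℂ :=
  (t.1.val * ((xi + 2) / 3), t.2.val * ((xi + 2) / 3))

/-! ### The `ℤ₃`-orbifold K3 surface: minimal resolution of `T / ℤ₃`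

Near the singular point labelled by `t`, `T / ℤ₃` is modelled by
`{x ∈ ℂ³ | x₀³ = x₁ x₂}` through `z ↦ (z₁ z₂, z₁³, z₂³)`, `z ∈ ℂ²` being the coordinates centred
at the fixed point. The minimal resolution is the blow-up of the origin, a subset of `ℂ³ × ℙ²`
whose exceptional divisor is `{0} × {u ∈ ℙ² | u₁ u₂ = 0}`. -/

/-- The projective plane. -/
abbrev P2 : Type := Projectivization ℂ (Fin 3 → ℂ)

/-- The line `{uᵢ = 0}` in the projective plane. -/
def coordLine (i : Fin 3) : Set P2 := {u | ∀ v ∈ u.submodule, v i = 0}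

/-- The set of points of the minimal resolution `X` of `T / ℤ₃`: the non-singular points of
`T / ℤ₃`, together with the exceptional curve `{u ∈ ℙ² | u₁ u₂ = 0}` over each of the
nine singular points. -/
inductive Surface : Type
  | reg (p : TorusModZ3) (hp : ¬ IsSingular p) : Surface
  | exc (t : Label) (u : P2) (hu : u ∈ coordLine 2 ∪ coordLine 1) : Surface

/-- The irreducible components of the exceptional divisor over the fixed point labelled by `t`:
`excCurve t 0` is `{u₂ = 0}` (the curve `C_t^{(1)}`) and `excCurve t 1` is `{u₁ = 0}`
(the curve `C_t^{(2)}`). -/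
def excCurve (t : Label) (k : Fin 2) : Set Surface :=
  {P | ∃ u hu, P = Surface.exc t u hu ∧ u ∈ coordLine (![2, 1] k)}

/-- The invariants `(x₀, x₁, x₂) = (z₁ z₂, z₁³, z₂³)`. -/
def invariants (z : ℂ × ℂ) : Fin 3 → ℂ := ![z.1 * z.2, z.1 ^ 3, z.2 ^ 3]

/-- The `ℂ³`-component of the standard parametrisation of the affine chart `{uⱼ ≠ 0}` of the
blow-up of `{x₀³ = x₁ x₂}` at the origin. The coordinates are `(u₁, u₂)` if `j = 0`,
`(u₀, x₁)` if `j = 1`, and `(u₀, x₂)` if `j = 2`. -/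
def chartX (j : Fin 3) (a : ℂ × ℂ) : Fin 3 → ℂ :=
  ![![a.1 * a.2, a.1 ^ 2 * a.2, a.1 * a.2 ^ 2],
    ![a.1 * a.2, a.2, a.1 ^ 3 * a.2 ^ 2],
    ![a.1 * a.2, a.1 ^ 3 * a.2 ^ 2, a.2]] j

/-- Homogeneous coordinates of the `ℙ²`-component of the same parametrisation. -/
def chartU (j : Fin 3) (a : ℂ × ℂ) : Fin 3 → ℂ :=
  ![![1, a.1, a.2],
    ![a.1, 1, a.1 ^ 3 * a.2],
    ![a.1, a.1 ^ 3 * a.2, 1]] j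

theorem chartU_ne_zero (j : Fin 3) (a : ℂ × ℂ) : chartU j a ≠ 0 := by
  intro h
  have := congrFun h j
  fin_cases j <;> simp [chartU] at this

/-- The local holomorphic coordinate systems of `X`: the coordinates of `ℂ²` on the
non-singular part of `T / ℤ₃`, and the three standard charts of the blow-up over each
singular point. -/
inductive Chart : Type
  | flat : Chart
  | blowUp (t : Label) (j : Fin 3) : Chart

/-- `HasCoord c a P` says that `P` is the point of `X` with coordinates `a` in the chart `c`.
Every chart is a local biholomorphism from an open subset of `ℂ²` to `X`
(injective only locally). -/
def HasCoord : Chart → ℂ × ℂ → Surface → Prop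
  | .flat, z, .reg p _ => p = proj z
  | .flat, _, .exc _ _ _ => False
  | .blowUp t j, a, .reg p _ =>
      chartX j a ≠ 0 ∧ ∃ z : ℂ × ℂ, invariants z = chartX j a ∧ p = proj (fixedPt t + z)
  | .blowUp t j, a, .exc s u _ =>
      chartX j a = 0 ∧ s = t ∧ u = Projectivization.mk ℂ (chartU j a) (chartU_ne_zero j a)

/-- `g` expresses the self-map `f` of `X` near the coordinates `a` in terms of the
charts `c` and `c'`. -/
def IsLocalExpr (f : Surface → Surface) (c c' : Chart) (a : ℂ × ℂ) (g : ℂ × ℂ → ℂ × ℂ) : Prop :=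
  ∀ᶠ b in 𝓝 a, ∀ Q : Surface, HasCoord c b Q → HasCoord c' (g b) (f Q)

/-- A self-map of `X` is holomorphic if near each point it is given by an analytic map in
suitable charts. -/
def IsHolomorphic (f : Surface → Surface) : Prop :=
  ∀ (c : Chart) (a : ℂ × ℂ) (P : Surface), HasCoord c a P →
    ∃ (c' : Chart) (g : ℂ × ℂ → ℂ × ℂ), AnalyticAt ℂ g a ∧ IsLocalExpr f c c' a g

/-- The holomorphic volume form `dz₁ ∧ dz₂`. -/
def volumeForm (v w : ℂ × ℂ) : ℂ := v.1 * w.2 - v.2 * w.1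

/-- The Kähler form `(i/2) (dz₁ ∧ dz̄₁ + dz₂ ∧ dz̄₂)` of the Euclidean metric. -/
def kahlerForm (v w : ℂ × ℂ) : ℝ :=
  (Complex.I / 2 * (v.1 * star w.1 - w.1 * star v.1 + (v.2 * star w.2 - w.2 * star v.2))).re

/-- `f` maps the complement of the exceptional divisor to itself, and there it pulls back both
the holomorphic volume form and the Kähler form induced from the Euclidean metric
on the torus to themselves. (The Kähler form lives on this complement; it degenerates along the
exceptional divisor.) -/
def PreservesForms (f : Surface → Surface) : Prop :=
  ∀ z : ℂ × ℂ, ¬ IsSingular (proj z) →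
    ∃ g : ℂ × ℂ → ℂ × ℂ, AnalyticAt ℂ g z ∧ IsLocalExpr f .flat .flat z g ∧
      ∀ v w : ℂ × ℂ,
        volumeForm (fderiv ℂ g z v) (fderiv ℂ g z w) = volumeForm v w ∧
        kahlerForm (fderiv ℂ g z v) (fderiv ℂ g z w) = kahlerForm v w

theorem IsLocalExpr.comp {f h : Surface → Surface} {c c' c'' : Chart} {a : ℂ × ℂ}
    {g k : ℂ × ℂ → ℂ × ℂ} (hh : IsLocalExpr h c' c'' (g a) k) (hf : IsLocalExpr f c c' a g)
    (hg : ContinuousAt g a) : IsLocalExpr (h ∘ f) c c'' a (k ∘ g) := by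
  filter_upwards [hf, hg.eventually hh] with b h1 h2 Q hQ
  exact h2 _ (h1 Q hQ)

theorem IsHolomorphic.comp {f h : Surface → Surface} (hh : IsHolomorphic h)
    (hf : IsHolomorphic f) : IsHolomorphic (h ∘ f) := by
  intro c a P hP
  obtain ⟨c', g, hg, hfg⟩ := hf c a P hP
  obtain ⟨c'', k, hk, hhk⟩ := hh c' (g a) (f P) (hfg.self_of_nhds P hP)
  exact ⟨c'', k ∘ g, hk.comp hg, hhk.comp hfg hg.continuousAt⟩

theorem PreservesForms.comp {f h : Surface → Surface} (hh : PreservesForms h)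
    (hf : PreservesForms f) : PreservesForms (h ∘ f) := by
  intro z hz
  obtain ⟨g, hg, hfg, hforms⟩ := hf z hz
  have h1 : HasCoord .flat (g z) (f (.reg (proj z) hz)) := hfg.self_of_nhds _ rfl
  have h2 : ¬ IsSingular (proj (g z)) := by
    cases hP : f (.reg (proj z) hz) with
    | reg p hp => rw [hP] at h1; exact (show p = proj (g z) from h1) ▸ hp
    | exc t u hu => rw [hP] at h1; exact h1.elim
  obtain ⟨k, hk, hhk, kforms⟩ := hh (g z) h2
  refine ⟨k ∘ g, hk.comp hg, hhk.comp hfg hg.continuousAt, fun v w => ?_⟩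
  rw [fderiv_comp z hk.differentiableAt hg.differentiableAt]
  simp only [ContinuousLinearMap.comp_apply]
  exact ⟨((kforms _ _).1).trans (hforms v w).1, ((kforms _ _).2).trans (hforms v w).2⟩

/-- The symmetry group of `X`: biholomorphic self-maps of `X` that leave
the holomorphic volume form and the Kähler form invariant. -/
def symmetryGroup : Subgroup (Equiv.Perm Surface) where
  carrier := {f | (IsHolomorphic f ∧ IsHolomorphic f.symm) ∧
    PreservesForms f ∧ PreservesForms f.symm}
  one_mem' := by
    have h1 : IsHolomorphic id := fun c a _ _ =>
      ⟨c, id, analyticAt_id, Filter.Eventually.of_forall fun _ _ hQ => hQ⟩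
    have h2 : PreservesForms id := fun z _ =>
      ⟨id, analyticAt_id, Filter.Eventually.of_forall fun _ _ hQ => hQ, by simp⟩
    exact ⟨⟨h1, h1⟩, h2, h2⟩
  mul_mem' := fun {h f} hh hf => ⟨⟨hh.1.1.comp hf.1.1, hf.1.2.comp hh.1.2⟩,
    hh.2.1.comp hf.2.1, hf.2.2.comp hh.2.2⟩
  inv_mem' := fun hf => ⟨⟨hf.1.2, hf.1.1⟩, hf.2.2, hf.2.1⟩

/-! ### The Niemeier lattice of type `A₂¹²` -/

/-- The rational vector space with basis the simple roots `Ẽ_j^{(l)}`; the index `j` traditionally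
runs through `1, …, 12` and `l` through `1, 2`, and both are shifted by one here. -/
abbrev RootSpace : Type := Fin 12 → Fin 2 → ℚ

/-- The simple root `Ẽ_j^{(l)}`. -/
def simpleRoot (j : Fin 12) (l : Fin 2) : RootSpace := Pi.single j (Pi.single l 1)

/-- The bilinear form of type `A₂¹²`: each `A₂` component has Gram matrix `(2, -1; -1, 2)`. -/
def rootForm (v w : RootSpace) : ℚ :=
  ∑ j, (2 * v j 0 * w j 0 + 2 * v j 1 * w j 1 - v j 0 * w j 1 - v j 1 * w j 0)

/-- The generating matrix of the extended ternary Golay code, with entries lifted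
to `{0, 1, -1}`. -/
def ternaryGolay : Matrix (Fin 6) (Fin 12) ℤ :=
  !![ 0,  1,  1,  1,  1,  1, 1, 0, 0, 0, 0, 0;
     -1,  0,  1, -1, -1,  1, 0, 1, 0, 0, 0, 0;
     -1,  1,  0,  1, -1, -1, 0, 0, 1, 0, 0, 0;
     -1, -1,  1,  0,  1, -1, 0, 0, 0, 1, 0, 0;
     -1, -1, -1,  1,  0,  1, 0, 0, 0, 0, 1, 0;
     -1,  1, -1, -1,  1,  0, 0, 0, 0, 0, 0, 1]

/-- The glue vectors `w_i = (1/3) ∑_j a_{ij} (Ẽ_j^{(1)} + 2 Ẽ_j^{(2)})`. -/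
def glueVector (i : Fin 6) : RootSpace :=
  (1 / 3 : ℚ) • ∑ j, (ternaryGolay i j : ℚ) • (simpleRoot j 0 + (2 : ℚ) • simpleRoot j 1)

/-- The Niemeier lattice `N` of type `A₂¹²`. -/
def niemeier : Submodule ℤ RootSpace :=
  Submodule.span ℤ (Set.range (fun q : Fin 12 × Fin 2 => simpleRoot q.1 q.2) ∪
    Set.range glueVector)

/-- `Φ` is (the `ℚ`-linear extension of) an automorphism of the lattice `N`. -/
def IsNiemeierAut (Φ : RootSpace ≃ₗ[ℚ] RootSpace) : Prop :=
  (∀ v w, rootForm (Φ v) (Φ w) = rootForm v w) ∧ ∀ v, Φ v ∈ niemeier ↔ v ∈ niemeier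

/-- The irreducible root sublattice `A_{2,j}` of `N`. -/
def rootComponent (j : Fin 12) : Submodule ℤ RootSpace :=
  Submodule.span ℤ (Set.range (simpleRoot j))

/-- `π` is the image of `Φ` under the projection of the automorphism group of `N` onto `M₁₂`:
the permutation induced by `Φ` on the twelve components `A_{2,j}`. -/
def InducesPerm (Φ : RootSpace ≃ₗ[ℚ] RootSpace) (π : Equiv.Perm (Fin 12)) : Prop :=
  ∀ j, Φ '' (rootComponent j : Set RootSpace) = rootComponent (π j)

/-- The sign and the component (shifted by one) which describe the embedding `ι` on the roots
`E_t^{(l)}`. -/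
def iotaData (t : Label) : ℚ × Fin 12 :=
  (![![(1, 5), (1, 3), (1, 6)],
     ![(-1, 4), (-1, 2), (-1, 1)],
     ![(1, 7), (1, 0), (1, 8)]] : Fin 3 → Fin 3 → ℚ × Fin 12) t.1 t.2

/-- The image `ι(E_t^{(l)})` in `N` of the class `E_t^{(l)}` of the exceptional
curve `C_t^{(l)}`. -/
def iota (t : Label) (l : Fin 2) : RootSpace := (iotaData t).1 • simpleRoot (iotaData t).2 l

/-- `Φ` extends the action of `f` on the lattice generated by the classes of the exceptional
curves, i.e. `Φ ∘ ι = ι ∘ f_*`. Here `f_*` maps the class of a curve to the class of its image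
under `f`. -/
def Extends (f : Equiv.Perm Surface) (Φ : RootSpace ≃ₗ[ℚ] RootSpace) : Prop :=
  ∀ t k, ∃ s l, f '' excCurve t k = excCurve s l ∧ Φ (iota t k) = iota s l

/-! ### The Mathieu group `M₂₄` -/

/-- The generating matrix of the extended binary Golay code. -/
def binaryGolay : Matrix (Fin 12) (Fin 24) (ZMod 2) :=
  !![1, 1, 1, 0, 1, 0, 0, 0, 0, 0, 0, 1, 0, 0, 0, 1, 0, 1, 0, 0, 0, 1, 0, 0;
     0, 0, 1, 1, 0, 1, 0, 0, 1, 0, 0, 0, 0, 0, 1, 0, 1, 0, 0, 0, 1, 1, 0, 0;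
     0, 0, 0, 1, 0, 0, 1, 1, 0, 1, 0, 1, 0, 0, 1, 1, 0, 0, 1, 0, 0, 0, 0, 0;
     0, 0, 0, 0, 0, 0, 1, 1, 0, 0, 1, 0, 0, 0, 1, 1, 1, 1, 0, 0, 0, 0, 1, 0;
     1, 1, 0, 1, 0, 0, 1, 1, 0, 0, 0, 0, 0, 0, 0, 1, 0, 1, 0, 0, 1, 0, 0, 0;
     1, 0, 0, 0, 1, 0, 0, 1, 0, 0, 0, 0, 1, 1, 0, 1, 0, 1, 0, 0, 0, 0, 1, 0;
     0, 0, 0, 0, 0, 0, 0, 0, 0, 1, 1, 1, 1, 1, 0, 0, 1, 0, 0, 1, 0, 1, 0, 0;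
     0, 0, 1, 0, 0, 0, 0, 1, 1, 0, 1, 0, 1, 0, 0, 0, 0, 1, 1, 0, 0, 0, 1, 0;
     0, 1, 0, 0, 1, 0, 0, 0, 1, 1, 0, 0, 0, 1, 0, 0, 0, 0, 1, 0, 1, 0, 0, 1;
     1, 0, 0, 1, 0, 0, 1, 1, 1, 0, 0, 0, 1, 0, 1, 1, 0, 1, 1, 0, 0, 1, 1, 0;
     1, 1, 1, 0, 0, 0, 1, 1, 0, 1, 1, 0, 1, 0, 0, 1, 0, 1, 0, 0, 0, 1, 1, 0;
     1, 1, 0, 0, 1, 0, 1, 1, 1, 1, 0, 1, 0, 0, 1, 1, 0, 1, 0, 0, 0, 0, 1, 0]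

/-- The extended binary Golay code; the labels `1, …, 24` of the entries are shifted by one. -/
def golayCode : Submodule (ZMod 2) (Fin 24 → ZMod 2) :=
  Submodule.span (ZMod 2) (Set.range fun i => binaryGolay i)

/-- The Mathieu group `M₂₄`: the permutations of the entries which preserve the extended
binary Golay code. -/
def M24 : Subgroup (Equiv.Perm (Fin 24)) where
  carrier := {σ | ∀ c : Fin 24 → ZMod 2, c ∘ σ ∈ golayCode ↔ c ∈ golayCode}
  one_mem' := fun _ => Iff.rfl
  mul_mem' := fun {σ τ} hσ hτ c => (hτ (c ∘ σ)).trans (hσ c)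
  inv_mem' := fun {σ} hσ c => by
    rw [← hσ (c ∘ ⇑σ⁻¹), Function.comp_assoc, ← Equiv.Perm.coe_mul, inv_mul_cancel]
    rfl

/-- The octad with the labels `3, 5, 6, 9, 15, 19, 23, 24` (shifted by one). -/
def octad : Set (Fin 24) := {2, 4, 5, 8, 14, 18, 22, 23}

/-- The subgroup of `M₂₄` of all permutations which map the octad to itself. This is the combined
symmetry group of all Kummer K3 surfaces. -/
def octadGroup : Subgroup (Equiv.Perm (Fin 24)) where
  carrier := {σ | σ ∈ M24 ∧ σ '' octad = octad}
  one_mem' := ⟨M24.one_mem, by simp⟩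
  mul_mem' := fun {σ τ} hσ hτ => ⟨M24.mul_mem hσ.1 hτ.1, by
    rw [Equiv.Perm.coe_mul, Set.image_comp, hτ.2, hσ.2]⟩
  inv_mem' := fun {σ} hσ => ⟨M24.inv_mem hσ.1, by
    conv_lhs => rw [← hσ.2]
    rw [← Set.image_comp, ← Equiv.Perm.coe_mul, inv_mul_cancel]
    simp⟩

/-- The relabelling of `1, …, 12` by the entries
`12, 8, 18, 13, 2, 16, 3, 23, 1, 6, 4, 9` of a dodecad (all labels shifted by one). -/
def dodecadLabel : Fin 12 → Fin 24 := ![11, 7, 17, 12, 1, 15, 2, 22, 0, 5, 3, 8]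

/-- `σ` is the image of `π` under the embedding of `M₁₂` into `M₂₄` as the stabilizer of the
dodecad: `σ` is the element of `M₂₄` which acts on the dodecad as `π` does. -/
def EmbedsAs (π : Equiv.Perm (Fin 12)) (σ : Equiv.Perm (Fin 24)) : Prop :=
  σ ∈ M24 ∧ ∀ i, σ (dodecadLabel i) = dodecadLabel (π i)

/-- The graph `σ = ϑ(f)` of the map `ϑ` from the symmetry group of `X` to `M₂₄`: the
action of `f` on the exceptional curves is extended to an automorphism `Φ` of `N`, which is
projected to a permutation `π` in `M₁₂`, which is mapped to `σ` in `M₂₄`. -/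
def IsTheta (f : Equiv.Perm Surface) (σ : Equiv.Perm (Fin 24)) : Prop :=
  ∃ (Φ : RootSpace ≃ₗ[ℚ] RootSpace) (π : Equiv.Perm (Fin 12)),
    IsNiemeierAut Φ ∧ Extends f Φ ∧ InducesPerm Φ π ∧ EmbedsAs π σ

/-- The image of the symmetry group of `X` under `ϑ`. -/
def thetaImage : Set (Equiv.Perm (Fin 24)) := {σ | ∃ f ∈ symmetryGroup, IsTheta f σ}

end

end Z3OrbifoldK3

namespace Z3OrbifoldK3

open Equiv

/-! ### Binary words as bit masks -/

/-! The first claim rests on the minimum distance 8 of the Golay code. If an element `σ` of `M24`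
fixes five entries of an octad, the octad and its preimage under `σ` differ in at most six entries,
so they coincide (`testBit_apply_of_fix`). Playing several octads against each other shows that an
element which fixes the entry 0 and six entries of the given octad is trivial (`eq_one_of_fix`).
Hence the stabilizer of 0 in the octad group acts faithfully on the octad. Explicit lifts show that
its image contains the alternating group; an odd element would yield a transposition, contradicting
rigidity (`map_pointStabilizer`). The complement of the octad is an affine space over 𝔽₂ whose
sixteen translations lie in `M24` and fix the octad pointwise. They act regularly on the complement,
so they form a normal complement to the point stabilizer.

For the second claim a single symmetry suffices: the translation of the torus by the fixed point
labelled (0, 1). It only shifts the labels of the exceptional curves, and a permutation of the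
components of the Niemeier lattice extends this action. The resulting `shiftTheta` fixes three octad
entries and, after correction by an octad group element, a fourth, while a further octad entry
leaves the octad. Together with the octad group it can move any element of `M24`, one entry at a
time, to an element fixing five octad entries, which stabilizes the octad
(`eq_M24_of_octadGroup_le`). -/

/-- The binary word of length 24 whose entries are the binary digits of `m`. -/
def word (m : ℕ) : Fin 24 → ZMod 2 := fun i => if m.testBit i then 1 else 0

theorem word_xor (a b : ℕ) : word (a ^^^ b) = word a + word b := by
  funext i
  simp only [word, Nat.testBit_xor, Pi.add_apply]
  cases a.testBit i <;> cases b.testBit i <;> decide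

theorem word_zero : word 0 = 0 := by
  funext i; simp [word]

theorem word_apply_eq_iff {m : ℕ} {i j : Fin 24} :
    word m i = word m j ↔ m.testBit i = m.testBit j := by
  simp only [word]
  cases m.testBit i <;> cases m.testBit j <;> simp

theorem word_apply_ne_zero {m : ℕ} {i : Fin 24} : word m i ≠ 0 ↔ m.testBit i = true := by
  simp only [word]
  cases m.testBit i <;> simp

theorem word_comp (m : ℕ) (f : Fin 24 → Fin 24) :
    word m ∘ f = word (Nat.ofBits fun i => m.testBit (f i)) := by
  funext i
  simp [word, Nat.testBit_ofBits_lt _ _ i.2]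

/-- The rows of `binaryGolay` as bit masks. -/
def golayMasks : List ℕ :=
  [2263063, 3227948, 314056, 4441280, 1212619, 4370577, 2702848, 4593028, 9708306, 6738377,
    6461127, 4377555]

/-- The entries of `binaryGolay`. -/
def golayEntry (i : Fin 12) (j : Fin 24) : ZMod 2 := binaryGolay i j

theorem range_binaryGolay :
    (Set.range fun i => binaryGolay i) = {c | ∃ m ∈ golayMasks, c = word m} := by
  have h' : ∀ (i : Fin 12) (j : Fin 24), golayEntry i j = word (golayMasks.get i) j := by
    decide +kernel
  have h : ∀ i : Fin 12, binaryGolay i = word (golayMasks.get i) := fun i => funext (h' i)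
  ext c
  simp only [Set.mem_range, Set.mem_ofPred_eq]
  constructor
  · rintro ⟨i, rfl⟩
    exact ⟨_, List.get_mem _ _, h i⟩
  · rintro ⟨m, hm, rfl⟩
    obtain ⟨i, rfl⟩ := List.get_of_mem hm
    exact ⟨i, h i⟩

theorem word_mem_golayCode_of_mem {m : ℕ} (hm : m ∈ golayMasks) : word m ∈ golayCode :=
  Submodule.subset_span (range_binaryGolay ▸ ⟨m, hm, rfl⟩)

/-- All sums of subfamilies of a family of bit masks. -/
def allSums : List ℕ → List ℕ
  | [] => [0]
  | m :: l => allSums l ++ (allSums l).map (m ^^^ ·)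

/-- Coefficients in 𝔽₂ are 0 or 1, so a span consists of subset sums. This turns statements about
the code into a search over 4096 masks. -/
theorem exists_mem_allSums (l : List ℕ) {c : Fin 24 → ZMod 2}
    (hc : c ∈ Submodule.span (ZMod 2) {c | ∃ m ∈ l, c = word m}) :
    ∃ m ∈ allSums l, c = word m := by
  induction l generalizing c with
  | nil => simpa [allSums, word_zero] using hc
  | cons m l ih =>
    have h : {c | ∃ k ∈ m :: l, c = word k} = insert (word m) {c | ∃ k ∈ l, c = word k} := by
      ext c; simp
    rw [h, Submodule.mem_span_insert] at hc
    obtain ⟨a, z, hz, rfl⟩ := hc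
    obtain ⟨k, hk, rfl⟩ := ih hz
    have ha : a = 0 ∨ a = 1 := by revert a; decide
    rcases ha with rfl | rfl
    · exact ⟨k, by simp [allSums, hk], by simp⟩
    · exact ⟨m ^^^ k, by simp [allSums, hk], by simp [word_xor]⟩

/-- The number of entries `1` of a bit mask of length 24. -/
def weight (m : ℕ) : ℕ := (Finset.univ.filter fun i : Fin 24 => m.testBit i).card

/-- The number of entries `1` among the first `n` binary digits of `m`. -/
def digitCount : ℕ → ℕ → ℕ
  | 0, _ => 0
  | n + 1, m => digitCount n (m / 2) + m % 2

theorem digitCount_eq_sum (n m : ℕ) :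
    digitCount n m = ∑ i ∈ Finset.range n, if m.testBit i then 1 else 0 := by
  induction n generalizing m with
  | zero => rfl
  | succ n ih =>
    rw [digitCount, ih, Finset.sum_range_succ']
    simp only [Nat.testBit_succ, Nat.testBit_zero, decide_eq_true_eq]
    congr 1
    split <;> omega

/-- Halving and remainders evaluate much faster than the cardinality of a filtered set; the
exhaustive check below uses them. -/
theorem weight_eq_digitCount (m : ℕ) : weight m = digitCount 24 m := by
  rw [digitCount_eq_sum, weight, Finset.card_filter,
    Fin.sum_univ_eq_sum_range fun i => if m.testBit i then 1 else 0]

/-- The test that `a ^^^ m` satisfies `p` for all `m` in `allSums l`. -/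
def testSums (p : ℕ → Bool) : List ℕ → ℕ → Bool
  | [], a => p a
  | m :: l, a => testSums p l a && testSums p l (a ^^^ m)

/-- The recursion walks the tree of subset sums with `a` as the running sum, so the full list is
never built. -/
theorem of_testSums {p : ℕ → Bool} (l : List ℕ) (a : ℕ) (h : testSums p l a = true) :
    ∀ m ∈ allSums l, p (a ^^^ m) = true := by
  induction l generalizing a with
  | nil => simpa [allSums, testSums] using h
  | cons k l ih =>
    rw [testSums, Bool.and_eq_true] at h
    intro m hm
    simp only [allSums, List.mem_append, List.mem_map] at hm
    rcases hm with hm | ⟨n, hn, rfl⟩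
    · exact ih _ h.1 m hm
    · rw [← Nat.xor_assoc]
      exact ih _ h.2 n hn

theorem weight_allSums : ∀ m ∈ allSums golayMasks, m = 0 ∨ 8 ≤ weight m := by
  have h := of_testSums (p := fun m => Nat.beq m 0 || Nat.ble 8 (digitCount 24 m)) golayMasks 0
    (by decide +kernel)
  simpa only [Nat.zero_xor, Bool.or_eq_true, Nat.beq_eq, Nat.ble_eq, weight_eq_digitCount] using h

/-- The extended binary Golay code has minimum distance 8. -/
theorem eq_zero_of_support_card_lt {c : Fin 24 → ZMod 2} (hc : c ∈ golayCode) {s : Finset (Fin 24)}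
    (hs : ∀ i, c i ≠ 0 → i ∈ s) (h : s.card < 8) : c = 0 := by
  rw [golayCode, range_binaryGolay] at hc
  obtain ⟨m, hm, rfl⟩ := exists_mem_allSums _ hc
  rcases weight_allSums m hm with rfl | h8
  · exact word_zero
  · have : weight m ≤ s.card := Finset.card_le_card fun i hi =>
      hs i (word_apply_ne_zero.2 (Finset.mem_filter.1 hi).2)
    omega

/-! ### Deciding membership in the code -/

/-- Words of the extended binary Golay code in echelon form, each with its pivot. -/
def echelon : List (ℕ × ℕ) :=
  [(21, 2263063), (20, 1296699), (18, 314056), (22, 4441280), (16, 84464), (13, 15777),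
    (19, 705094), (14, 21116), (23, 8521420), (17, 138790), (15, 36294), (12, 5279)]

/-- Reduction of a bit mask modulo the words of an echelon form. -/
def reduce : List (ℕ × ℕ) → ℕ → ℕ
  | [], m => m
  | (p, r) :: l, m => reduce l (if m.testBit p then m ^^^ r else m)

/-- Each reduction step adds zero or a code word, so the class modulo the code never changes. Only
this soundness is needed, not that the list is in echelon form. -/
theorem word_mem_of_reduce_eq_zero {l : List (ℕ × ℕ)} (hl : ∀ q ∈ l, word q.2 ∈ golayCode)
    {m : ℕ} (h : reduce l m = 0) : word m ∈ golayCode := by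
  induction l generalizing m with
  | nil => rw [show m = 0 from h, word_zero]; exact golayCode.zero_mem
  | cons q l ih =>
    have h1 := ih (fun q hq => hl q (List.mem_cons_of_mem _ hq)) h
    have h2 := hl q List.mem_cons_self
    split at h1
    · rw [word_xor] at h1
      exact (golayCode.add_mem_iff_left h2).1 h1
    · exact h1

/-- The sum of the bit masks in a list which are selected by the binary digits of `k`. -/
def selectSum : List ℕ → ℕ → ℕ
  | [], _ => 0
  | m :: l, k => if k % 2 = 1 then m ^^^ selectSum l (k / 2) else selectSum l (k / 2)

theorem word_selectSum_mem (l : List ℕ) (hl : ∀ m ∈ l, word m ∈ golayCode) (k : ℕ) :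
    word (selectSum l k) ∈ golayCode := by
  induction l generalizing k with
  | nil => rw [selectSum, word_zero]; exact golayCode.zero_mem
  | cons m l ih =>
    have h := ih (fun m hm => hl m (List.mem_cons_of_mem _ hm)) (k / 2)
    rw [selectSum]
    split
    · rw [word_xor]
      exact golayCode.add_mem (hl m List.mem_cons_self) h
    · exact h

theorem echelon_mem : ∀ q ∈ echelon, word q.2 ∈ golayCode := by
  -- The binary digits of `k` record which generators add up to the echelon word.
  have h : ∀ q ∈ echelon,
      ∃ k ∈ [1, 3, 4, 8, 19, 59, 105, 159, 432, 542, 1540, 2180], q.2 = selectSum golayMasks k := by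
    decide +kernel
  intro q hq
  obtain ⟨k, -, h⟩ := h q hq
  rw [h]
  exact word_selectSum_mem _ (fun _ => word_mem_golayCode_of_mem) k

theorem word_mem_golayCode {m : ℕ} (h : reduce echelon m = 0) : word m ∈ golayCode :=
  word_mem_of_reduce_eq_zero echelon_mem h

/-! ### Elements of the Mathieu group -/

/-- The inverse of `σ` is a power of `σ`, so one implication gives the other. -/
theorem mem_M24_of_comp_mem {σ : Perm (Fin 24)} (h : ∀ c ∈ golayCode, c ∘ σ ∈ golayCode) :
    σ ∈ M24 := by
  have hpow : ∀ (n : ℕ) (c), c ∈ golayCode → c ∘ ⇑(σ ^ n) ∈ golayCode := by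
    intro n
    induction n with
    | zero => intro c hc; simpa using hc
    | succ n ih =>
      intro c hc
      rw [pow_succ, Perm.coe_mul, ← Function.comp_assoc]
      exact h _ (ih c hc)
  intro c
  refine ⟨fun hc => ?_, h c⟩
  have h1 := hpow (orderOf σ - 1) _ hc
  rwa [Function.comp_assoc, ← Perm.coe_mul, ← pow_succ', Nat.sub_add_cancel (orderOf_pos σ),
    pow_orderOf_eq_one, Perm.coe_one, Function.comp_id] at h1

/-- The computable test that a permutation maps the generators of the code into the code. -/
def PreservesGolay (f : Fin 24 → Fin 24) : Prop :=
  ∀ m ∈ golayMasks, reduce echelon (Nat.ofBits fun i : Fin 24 => m.testBit (f i)) = 0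

instance (f : Fin 24 → Fin 24) : Decidable (PreservesGolay f) :=
  inferInstanceAs (Decidable (∀ m ∈ golayMasks, _))

theorem mem_M24_of_preservesGolay {σ : Perm (Fin 24)} (h : PreservesGolay σ) : σ ∈ M24 := by
  refine mem_M24_of_comp_mem fun c hc => ?_
  suffices golayCode ≤ golayCode.comap (LinearMap.funLeft (ZMod 2) (ZMod 2) σ) from this hc
  refine Submodule.span_le.2 ?_
  rw [range_binaryGolay]
  rintro _ ⟨m, hm, rfl⟩
  change word m ∘ σ ∈ golayCode
  rw [word_comp]
  exact word_mem_golayCode (h m hm)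

/-- An element of `M₂₄` which fixes five entries of an octad maps the octad to itself. -/
theorem testBit_apply_of_fix {σ : Perm (Fin 24)} (hσ : σ ∈ M24) {m : ℕ}
    (hm : reduce echelon m = 0) (hw : weight m = 8) {s : Finset (Fin 24)} (hs : 5 ≤ s.card)
    (hfix : ∀ i ∈ s, m.testBit i = true ∧ σ i = i) (i : Fin 24) :
    m.testBit (σ i) = m.testBit i := by
  have hc := word_mem_golayCode hm
  set B := Finset.univ.filter fun i : Fin 24 => m.testBit i with hB
  have hsB : s ⊆ B := fun i hi => by simp [hB, (hfix i hi).1]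
  have hsB' : s ⊆ B.map σ.symm.toEmbedding := fun i hi => by
    rw [Finset.mem_map_equiv, Equiv.symm_symm, (hfix i hi).2]
    exact hsB hi
  -- Both words have weight 8 and contain `s`, so they differ in at most 3 + 3 entries.
  have h0 : word m ∘ σ - word m = 0 := by
    refine eq_zero_of_support_card_lt (s := (B \ s) ∪ (B.map σ.symm.toEmbedding \ s))
      (golayCode.sub_mem ((hσ _).2 hc) hc) (fun i hi => ?_) ?_
    · have his : i ∉ s := fun h => hi (by simp [(hfix i h).2])
      have : word m i ≠ 0 ∨ word m (σ i) ≠ 0 := by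
        by_contra! h
        exact hi (by simp [h])
      rw [word_apply_ne_zero, word_apply_ne_zero] at this
      simpa [hB, his, Finset.mem_map_equiv] using this
    · have h1 := Finset.card_union_le (B \ s) (B.map σ.symm.toEmbedding \ s)
      rw [Finset.card_sdiff_of_subset hsB, Finset.card_sdiff_of_subset hsB',
        Finset.card_map, show B.card = 8 from hw] at h1
      omega
  exact word_apply_eq_iff.1 (congrFun (sub_eq_zero.1 h0) i)

/-- The enumeration of the octad. -/
def octadPt : Fin 8 → Fin 24 := ![5, 8, 23, 14, 2, 4, 18, 22]

theorem octadPt_injective : Function.Injective octadPt := by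
  unfold Function.Injective; decide

theorem octad_eq_range : octad = Set.range octadPt := by
  ext k
  rw [show k ∈ octad ↔ k ∈ ({2, 4, 5, 8, 14, 18, 22, 23} : Finset (Fin 24)) by simp [octad]]
  revert k
  simp only [Set.mem_range]
  decide

/-- An element of `M₂₄` which fixes the entry `0` and all but two entries of the octad
is trivial. -/
theorem eq_one_of_fix {σ : Perm (Fin 24)} (hσ : σ ∈ M24) (h0 : σ 0 = 0)
    (hfix : ∀ i : Fin 8, 2 ≤ i → σ (octadPt i) = octadPt i) : σ = 1 := by
  let F : Finset (Fin 24) := {0, 23, 14, 2, 4, 18, 22}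
  have hF : ∀ k ∈ F, σ k = k := by
    have : ∀ k ∈ F, k = 0 ∨ ∃ i : Fin 8, 2 ≤ i ∧ k = octadPt i := by decide
    intro k hk
    rcases this k hk with rfl | ⟨i, hi, rfl⟩
    · exact h0
    · exact hfix i hi
  -- Ten octads, each meeting the seven fixed entries in at least five and hence invariant under
  -- `σ`. They separate all entries except 5 from 8.
  let L : List ℕ := [6053905, 12656663, 4505735, 9830549, 12599513, 8675909, 12861748, 13370381,
    10765331, 15747077]
  have hL : ∀ m ∈ L, reduce echelon m = 0 ∧ weight m = 8 ∧
      5 ≤ (F.filter fun i : Fin 24 => m.testBit i).card := by decide +kernel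
  have hinv : ∀ m ∈ L, ∀ k, m.testBit (σ k) = m.testBit k := fun m hm k => by
    obtain ⟨h1, h2, h3⟩ := hL m hm
    refine testBit_apply_of_fix hσ h1 h2 h3 (fun i hi => ?_) k
    rw [Finset.mem_filter] at hi
    exact ⟨hi.2, hF i hi.1⟩
  have hsep : ∀ k l : Fin 24, (∀ m ∈ L, m.testBit l = m.testBit k) →
      l = k ∨ (k = 5 ∧ l = 8) ∨ (k = 8 ∧ l = 5) := by decide +kernel
  have h5 : σ 5 = 5 := by
    rcases hsep 5 (σ 5) fun m hm => hinv m hm 5 with h | ⟨-, h⟩ | ⟨h, -⟩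
    · exact h
    · have hother : ∀ k : Fin 24, k ≠ 5 → k ≠ 8 → σ k = k := fun k h1 h2 => by
        rcases hsep k (σ k) fun m hm => hinv m hm k with h | ⟨h, -⟩ | ⟨h, -⟩
        · exact h
        · exact absurd h h1
        · exact absurd h h2
      -- Here `σ` would be the transposition of 5 and 8. This octad contains 5 but not 8, and five
      -- of its other entries are fixed, so it would be invariant.
      have := testBit_apply_of_fix (m := 11952160) (s := {13, 14, 17, 18, 20}) hσ
        (by decide +kernel) (by decide +kernel) (by decide)
        (fun i hi => ⟨by revert i; decide, hother i (by rintro rfl; revert hi; decide)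
          (by rintro rfl; revert hi; decide)⟩) 5
      rw [h] at this
      exact absurd this (by decide)
    · exact absurd h (by decide)
  ext1 k
  rcases hsep k (σ k) fun m hm => hinv m hm k with h | ⟨rfl, h⟩ | ⟨rfl, h⟩
  · exact h
  · exact h5
  · exact absurd (σ.injective (h.trans h5.symm)) (by decide)

/-! ### The translations -/

/-- The affine space over `𝔽₂` formed by the complement of the octad. -/
abbrev AffineLabel : Type := Fin 4 → ZMod 2

/-- The entry outside the octad with given affine coordinates. -/
def affinePt (v : AffineLabel) : Fin 24 :=
  (![0, 1, 3, 17, 6, 20, 7, 15, 9, 19, 21, 10, 13, 16, 12, 11] : Fin 16 → Fin 24)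
    (Fin.ofNat 16 ((v 0).val + 2 * (v 1).val + 4 * (v 2).val + 8 * (v 3).val))

/-- The affine coordinates of the entries outside the octad. -/
def affineCoord (k : Fin 24) : AffineLabel :=
  -- The bare zeros sit at the octad entries and are placeholders.
  (![![0, 0, 0, 0], ![1, 0, 0, 0], 0, ![0, 1, 0, 0], 0, 0, ![0, 0, 1, 0], ![0, 1, 1, 0], 0,
    ![0, 0, 0, 1], ![1, 1, 0, 1], ![1, 1, 1, 1], ![0, 1, 1, 1], ![0, 0, 1, 1], 0, ![1, 1, 1, 0],
    ![1, 0, 1, 1], ![1, 1, 0, 0], 0, ![1, 0, 0, 1], ![1, 0, 1, 0], ![0, 1, 0, 1], 0, 0] :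
    Fin 24 → AffineLabel) k

theorem affineCoord_affinePt : ∀ v, affineCoord (affinePt v) = v := by decide +kernel

theorem affinePt_ne_octadPt : ∀ v i, affinePt v ≠ octadPt i := by decide +kernel

theorem eq_octadPt_or_eq_affinePt :
    ∀ k, (∃ i, k = octadPt i) ∨ affinePt (affineCoord k) = k := by decide +kernel

theorem affinePt_zero : affinePt 0 = 0 := by decide +kernel

/-- The map which fixes the octad pointwise and translates its complement. -/
def translateFun (v : AffineLabel) (k : Fin 24) : Fin 24 :=
  if ∃ i, k = octadPt i then k else affinePt (affineCoord k + v)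

theorem translateFun_octadPt (v : AffineLabel) (i : Fin 8) :
    translateFun v (octadPt i) = octadPt i :=
  if_pos ⟨i, rfl⟩

theorem translateFun_affinePt (v w : AffineLabel) :
    translateFun v (affinePt w) = affinePt (w + v) := by
  rw [translateFun, if_neg fun ⟨i, hi⟩ => affinePt_ne_octadPt w i hi, affineCoord_affinePt]

theorem translateFun_add (v w : AffineLabel) (k : Fin 24) :
    translateFun (v + w) k = translateFun v (translateFun w k) := by
  rcases eq_octadPt_or_eq_affinePt k with ⟨i, rfl⟩ | h
  · simp only [translateFun_octadPt]
  · rw [← h]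
    simp only [translateFun_affinePt]
    rw [add_comm v w, add_assoc]

theorem translateFun_zero (k : Fin 24) : translateFun 0 k = k := by
  rcases eq_octadPt_or_eq_affinePt k with ⟨i, rfl⟩ | h
  · exact translateFun_octadPt 0 i
  · rw [← h, translateFun_affinePt, add_zero]

/-- The permutation which fixes the octad pointwise and translates its complement. -/
def translate (v : AffineLabel) : Perm (Fin 24) where
  toFun := translateFun v
  invFun := translateFun (-v)
  left_inv k := by rw [← translateFun_add, neg_add_cancel, translateFun_zero]
  right_inv k := by rw [← translateFun_add, add_neg_cancel, translateFun_zero]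

/-- The affine labelling of the complement is chosen to make this finite check succeed. -/
theorem preservesGolay_translateFun : ∀ v, PreservesGolay (translateFun v) := by
  decide +kernel

theorem translate_mem_M24 (v : AffineLabel) : translate v ∈ M24 :=
  mem_M24_of_preservesGolay (preservesGolay_translateFun v)

theorem translate_octadPt (v : AffineLabel) (i : Fin 8) : translate v (octadPt i) = octadPt i :=
  translateFun_octadPt v i

theorem mem_octadGroup_of_octadPt {σ : Perm (Fin 24)} (h : σ ∈ M24)
    (hσ : ∀ i, ∃ j, σ (octadPt i) = octadPt j) : σ ∈ octadGroup := by
  refine ⟨h, Set.eq_of_subset_of_ncard_le ?_ ?_ (Set.toFinite _)⟩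
  · rw [octad_eq_range]
    rintro _ ⟨_, ⟨i, rfl⟩, rfl⟩
    obtain ⟨j, hj⟩ := hσ i
    exact ⟨j, hj.symm⟩
  · rw [Set.ncard_image_of_injective _ σ.injective]

theorem translate_mem_octadGroup (v : AffineLabel) : translate v ∈ octadGroup :=
  mem_octadGroup_of_octadPt (translate_mem_M24 v) fun i => ⟨i, translate_octadPt v i⟩

/-! ### The action on the octad -/

theorem apply_mem_octad_iff (g : octadGroup) (k : Fin 24) : g.1 k ∈ octad ↔ k ∈ octad := by
  conv_lhs => rw [← g.2.2]
  exact g.1.injective.mem_set_image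

/-- The octad as an indexed set. -/
noncomputable def octadEquiv : Fin 8 ≃ {k : Fin 24 // k ∈ octad} :=
  (Equiv.ofInjective octadPt octadPt_injective).trans (Equiv.setCongr octad_eq_range.symm)

theorem octadEquiv_apply (i : Fin 8) : (octadEquiv i : Fin 24) = octadPt i := rfl

/-- The action of the stabilizer of the octad on the octad. -/
noncomputable def octadAction : octadGroup →* Perm (Fin 8) where
  toFun g := octadEquiv.symm.permCongr (g.1.subtypePerm fun k => apply_mem_octad_iff g k)
  map_one' := by ext1 i; simp
  map_mul' g h := by ext1 i; simp

theorem octadPt_octadAction (g : octadGroup) (i : Fin 8) :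
    octadPt (octadAction g i) = g.1 (octadPt i) := by
  rw [← octadEquiv_apply, ← octadEquiv_apply]
  simp [octadAction]

theorem octadAction_eq_iff (g : octadGroup) (α : Perm (Fin 8)) :
    octadAction g = α ↔ ∀ i, g.1 (octadPt i) = octadPt (α i) := by
  rw [Equiv.ext_iff]
  exact forall_congr' fun i => by rw [← octadPt_octadAction, octadPt_injective.eq_iff]

/-- The stabilizer of the entry `0` in the stabilizer of the octad. -/
def pointStabilizer : Subgroup octadGroup :=
  (MulAction.stabilizer (Perm (Fin 24)) (0 : Fin 24)).subgroupOf octadGroup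

theorem mem_pointStabilizer {g : octadGroup} : g ∈ pointStabilizer ↔ g.1 0 = 0 := Iff.rfl

theorem eq_one_of_octadAction {g : octadGroup} (hg : g ∈ pointStabilizer)
    (h : ∀ i : Fin 8, 2 ≤ i → octadAction g i = i) : g = 1 :=
  Subtype.ext (eq_one_of_fix g.2.1 hg fun i hi => by rw [← octadPt_octadAction, h i hi])

/-- Elements of the stabilizer of the octad which fix the entry `0` and act on the octad
as products of two transpositions. -/
def liftTable : Fin 6 → Fin 24 → Fin 24 :=
  ![![0, 7, 2, 16, 4, 23, 21, 15, 5, 17, 9, 3, 6, 19, 14, 1, 11, 10, 18, 20, 13, 12, 22, 8],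
    ![0, 16, 2, 10, 4, 14, 12, 20, 5, 11, 19, 15, 21, 1, 8, 9, 13, 7, 18, 3, 17, 6, 22, 23],
    ![0, 10, 8, 7, 4, 2, 3, 6, 5, 15, 21, 9, 17, 20, 14, 11, 12, 16, 18, 13, 19, 1, 22, 23],
    ![0, 15, 2, 19, 8, 4, 9, 1, 5, 13, 3, 21, 16, 6, 14, 7, 17, 12, 18, 10, 11, 20, 22, 23],
    ![0, 13, 2, 6, 4, 18, 7, 3, 5, 10, 17, 20, 19, 16, 14, 12, 1, 9, 8, 15, 21, 11, 22, 23],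
    ![0, 21, 2, 11, 4, 22, 13, 17, 5, 6, 1, 16, 15, 9, 14, 19, 3, 20, 18, 12, 7, 10, 8, 23]]

/-- These products generate the alternating group, so explicit lifts of six of them suffice. -/
theorem exists_lift_generator (i : Fin 8) (hi : 2 ≤ i) :
    ∃ g ∈ pointStabilizer, octadAction g = swap 0 1 * swap 0 i := by
  obtain ⟨n, rfl⟩ : ∃ n : Fin 6, i = Fin.ofNat 8 (n + 2) := by
    revert i; decide
  have hinj : ∀ (n : Fin 6) (k l), liftTable n k = liftTable n l → k = l := by decide +kernel
  have hG : ∀ n : Fin 6, PreservesGolay (liftTable n) := by decide +kernel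
  have hact : ∀ (n : Fin 6) (i : Fin 8), liftTable n (octadPt i) =
      octadPt ((swap 0 1 * swap 0 (Fin.ofNat 8 (n + 2)) : Perm (Fin 8)) i) := by decide +kernel
  have h0 : ∀ n : Fin 6, liftTable n 0 = 0 := by decide
  let σ : Perm (Fin 24) := Equiv.ofBijective (liftTable n) (Finite.injective_iff_bijective.1
    fun k l => hinj n k l)
  have hσ : σ ∈ octadGroup := mem_octadGroup_of_octadPt
    (mem_M24_of_preservesGolay (hG n)) fun i => ⟨_, hact n i⟩
  exact ⟨⟨σ, hσ⟩, h0 n, (octadAction_eq_iff _ _).2 (hact n)⟩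

/-- The products of two transpositions which move a fixed point generate the alternating
group. -/
theorem alternatingGroup_le_of_swap_mul_swap_mem {α : Type*} [Fintype α] [DecidableEq α]
    {a b : α} (hab : a ≠ b) {R : Subgroup (Perm α)}
    (hR : ∀ i, i ≠ a → i ≠ b → swap a b * swap a i ∈ R) : alternatingGroup α ≤ R := by
  have hu : ∀ i, i ≠ a → swap a b * swap a i ∈ R ⊓ alternatingGroup α := by
    intro i hi
    refine ⟨?_, ?_⟩
    · by_cases hb : i = b
      · rw [hb, swap_mul_self]; exact R.one_mem
      · exact hR i hi hb
    · change swap a b * swap a i ∈ alternatingGroup α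
      rw [Perm.mem_alternatingGroup, Perm.sign_mul, Perm.sign_swap hab,
        Perm.sign_swap hi.symm]
      rfl
  set S := R ⊓ alternatingGroup α
  -- `P` describes the union of `S` and its coset by `swap a b`. Transpositions moving `a` preserve
  -- this union and generate all permutations, so it is everything; parity then rules out the second
  -- coset for even permutations.
  let P : Perm α → Prop := fun π => π ∈ S ∨ swap a b * π ∈ S
  have hstar : ∀ i, i ≠ a → ∀ π, P π → P (swap a i * π) := by
    rintro i hi π (h | h)
    · right
      rw [← mul_assoc]
      exact S.mul_mem (hu i hi) h
    · left
      have := S.mul_mem (S.inv_mem (hu i hi)) h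
      rwa [mul_inv_rev, swap_inv, swap_inv, mul_assoc, swap_mul_self_mul] at this
  have hP : ∀ π, P π := by
    intro π
    induction π using Perm.swap_induction_on with
    | one => exact Or.inl S.one_mem
    | swap_mul f x y hxy hf =>
      by_cases hx : x = a
      · subst hx; exact hstar y hxy.symm f hf
      by_cases hy : y = a
      · subst hy; rw [swap_comm]; exact hstar x hxy f hf
      have h : swap x y = swap a x * (swap a y * swap a x) := by
        rw [← mul_assoc, swap_comm a y, swap_mul_swap_mul_swap hy hxy.symm]
      rw [h, mul_assoc, mul_assoc]
      exact hstar x hx _ (hstar y hy _ (hstar x hx _ hf))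
  intro π hπ
  rcases hP π with h | h
  · exact h.1
  · have h2 : swap a b * π ∈ alternatingGroup α := h.2
    rw [Perm.mem_alternatingGroup, Perm.sign_mul, Perm.sign_swap hab,
      Perm.mem_alternatingGroup.1 hπ] at h2
    exact absurd h2 (by decide)

/-- The point stabilizer acts on the octad as the alternating group. -/
theorem map_pointStabilizer : pointStabilizer.map octadAction = alternatingGroup (Fin 8) := by
  have hle : alternatingGroup (Fin 8) ≤ pointStabilizer.map octadAction :=
    alternatingGroup_le_of_swap_mul_swap_mem (show (0 : Fin 8) ≠ 1 by decide) fun i h0 h1 => by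
      obtain ⟨g, hg, h⟩ := exists_lift_generator i (by revert i; decide)
      exact ⟨g, hg, h⟩
  refine le_antisymm ?_ hle
  rintro _ ⟨g, hg, rfl⟩
  rw [Perm.mem_alternatingGroup]
  rcases Int.units_eq_one_or (Perm.sign (octadAction g)) with h | h
  · exact h
  · exfalso
    -- If `g` acts oddly, some `k` in the point stabilizer acts as `g` followed by `swap 0 1`. Then
    -- `k * g⁻¹` acts as a transposition, although rigidity makes it trivial.
    obtain ⟨k, hk, hkg⟩ := hle (show swap 0 1 * octadAction g ∈ alternatingGroup (Fin 8) by
      rw [Perm.mem_alternatingGroup, Perm.sign_mul, Perm.sign_swap (by decide), h]; rfl)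
    have hkg' : octadAction (k * g⁻¹) = swap 0 1 := by
      rw [map_mul, map_inv, hkg, mul_inv_cancel_right]
    have h1 := eq_one_of_octadAction (pointStabilizer.mul_mem hk (pointStabilizer.inv_mem hg))
      fun i hi => by
        rw [hkg']
        revert i
        decide
    rw [h1, map_one] at hkg'
    exact absurd (congrArg (fun π : Perm (Fin 8) => π 0) hkg') (by decide)

theorem octadAction_mem_alternatingGroup {g : octadGroup} (hg : g ∈ pointStabilizer) :
    octadAction g ∈ alternatingGroup (Fin 8) :=
  map_pointStabilizer ▸ ⟨g, hg, rfl⟩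

/-- The point stabilizer is isomorphic to the alternating group. -/
noncomputable def pointStabilizerEquiv : pointStabilizer ≃* alternatingGroup (Fin 8) :=
  MulEquiv.ofBijective
    ((octadAction.comp pointStabilizer.subtype).codRestrict (alternatingGroup (Fin 8))
      fun g => octadAction_mem_alternatingGroup g.2) <| by
    constructor
    · rw [injective_iff_map_eq_one]
      intro g hg
      refine Subtype.ext (eq_one_of_octadAction g.2 fun i _ => ?_)
      rw [show octadAction g = 1 from congrArg Subtype.val hg, Perm.one_apply]
    · rintro ⟨α, hα⟩
      obtain ⟨g, hg, h⟩ := map_pointStabilizer.ge hα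
      exact ⟨⟨g, hg⟩, Subtype.ext h⟩

/-- The translations as elements of the stabilizer of the octad. -/
def translateHom : Multiplicative AffineLabel →* octadGroup where
  toFun v := ⟨translate v.toAdd, translate_mem_octadGroup _⟩
  map_one' := Subtype.ext (Equiv.ext translateFun_zero)
  map_mul' v w := Subtype.ext (Equiv.ext (translateFun_add v.toAdd w.toAdd))

theorem translateHom_apply_zero (v : Multiplicative AffineLabel) :
    (translateHom v).1 0 = affinePt v.toAdd := by
  have := translateFun_affinePt v.toAdd 0
  rwa [affinePt_zero, zero_add] at this

theorem translateHom_mem_ker (v : Multiplicative AffineLabel) :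
    translateHom v ∈ octadAction.ker :=
  (octadAction_eq_iff _ _).2 fun i => translate_octadPt _ i

/-- Every element of the stabilizer of the octad is the product of a translation and of an element
of the point stabilizer. -/
theorem exists_translateHom_mul (g : octadGroup) :
    ∃ v, ∃ k ∈ pointStabilizer, translateHom v * k = g := by
  have h0 : ∃ v, affinePt v = g.1 0 := by
    rcases eq_octadPt_or_eq_affinePt (g.1 0) with ⟨i, hi⟩ | h
    · have h1 := (apply_mem_octad_iff g 0).1 (by rw [hi, octad_eq_range]; exact ⟨i, rfl⟩)
      rw [octad_eq_range] at h1
      obtain ⟨j, hj⟩ := h1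
      exact absurd (affinePt_zero.trans hj.symm) (affinePt_ne_octadPt 0 j)
    · exact ⟨_, h⟩
  obtain ⟨v, hv⟩ := h0
  refine ⟨Multiplicative.ofAdd v, (translateHom (Multiplicative.ofAdd v))⁻¹ * g, ?_,
    mul_inv_cancel_left _ _⟩
  rw [mem_pointStabilizer, Subgroup.coe_mul, Subgroup.coe_inv, Perm.mul_apply, Perm.inv_eq_iff_eq,
    translateHom_apply_zero, toAdd_ofAdd, hv]

theorem eq_one_of_mem_ker_of_mem_pointStabilizer {g : octadGroup} (h1 : g ∈ octadAction.ker)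
    (h2 : g ∈ pointStabilizer) : g = 1 :=
  eq_one_of_octadAction h2 fun i _ => by rw [MonoidHom.mem_ker.1 h1, Perm.one_apply]

/-- The pointwise stabilizer of the octad is the group of translations. -/
noncomputable def translateEquiv : Multiplicative AffineLabel ≃* octadAction.ker :=
  MulEquiv.ofBijective (translateHom.codRestrict _ translateHom_mem_ker) <| by
    constructor
    · intro v w h
      have h1 : translateHom v = translateHom w := congrArg Subtype.val h
      have h2 := translateHom_apply_zero v
      rw [h1, translateHom_apply_zero] at h2
      have h3 := congrArg affineCoord h2
      rw [affineCoord_affinePt, affineCoord_affinePt] at h3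
      exact h3.symm
    · rintro ⟨g, hg⟩
      obtain ⟨v, k, hk, rfl⟩ := exists_translateHom_mul g
      have hk1 := (octadAction.ker.mul_mem_cancel_left (translateHom_mem_ker v)).1 hg
      obtain rfl := eq_one_of_mem_ker_of_mem_pointStabilizer hk1 hk
      exact ⟨v, Subtype.ext (mul_one _).symm⟩

theorem isComplement'_ker_pointStabilizer :
    Subgroup.IsComplement' octadAction.ker pointStabilizer := by
  refine Subgroup.isComplement'_of_disjoint_and_mul_eq_univ ?_ ?_
  · rw [Subgroup.disjoint_def]
    exact eq_one_of_mem_ker_of_mem_pointStabilizer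
  · refine Set.eq_univ_of_forall fun g => ?_
    obtain ⟨v, k, hk, rfl⟩ := exists_translateHom_mul g
    exact Set.mul_mem_mul (translateHom_mem_ker v) hk

/-- The stabilizer of the octad is of type `2⁴ : A₈`. -/
theorem exists_octadGroup_mulEquiv :
    ∃ φ : alternatingGroup (Fin 8) →* MulAut (Multiplicative (Fin 4 → ZMod 2)),
      Nonempty (octadGroup ≃*
        SemidirectProduct (Multiplicative (Fin 4 → ZMod 2)) (alternatingGroup (Fin 8)) φ) :=
  ⟨_, ⟨(SemidirectProduct.mulEquivSubgroup isComplement'_ker_pointStabilizer).symm.trans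
    (SemidirectProduct.congr' translateEquiv.symm pointStabilizerEquiv)⟩⟩

/-! ### Generating the Mathieu group -/

theorem exists_octadGroup_of_even {α : Perm (Fin 8)} (hα : Perm.sign α = 1) :
    ∃ g ∈ octadGroup, ∀ i, g (octadPt i) = octadPt (α i) := by
  obtain ⟨g, -, h⟩ := map_pointStabilizer.ge (Perm.mem_alternatingGroup.2 hα)
  exact ⟨g.1, g.2, (octadAction_eq_iff g α).1 h⟩

/-- For `k ≤ 4`, an even permutation of eight objects can fix the first `k` of them and
move any of the others to the next one. -/
theorem exists_even_perm (k i : Fin 8) (hk : k ≤ 4) (hi : k ≤ i) :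
    ∃ α : Perm (Fin 8), Perm.sign α = 1 ∧ (∀ j < k, α j = j) ∧ α i = k := by
  rcases hi.eq_or_lt with rfl | hi
  · exact ⟨1, Perm.sign_one, fun _ _ => rfl, rfl⟩
  · obtain ⟨a, b, hab, hka, hkb, ha, hb⟩ : ∃ a b : Fin 8,
        a ≠ b ∧ k < a ∧ k < b ∧ a ≠ i ∧ b ≠ i := by
      revert k i; decide
    refine ⟨swap k i * swap a b, ?_, fun j hj => ?_, ?_⟩
    · rw [Perm.sign_mul, Perm.sign_swap hi.ne, Perm.sign_swap hab]; rfl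
    · rw [Perm.mul_apply, swap_apply_of_ne_of_ne (hj.trans hka).ne (hj.trans hkb).ne,
        swap_apply_of_ne_of_ne hj.ne (hj.trans hi).ne]
    · rw [Perm.mul_apply, swap_apply_of_ne_of_ne ha.symm hb.symm, swap_apply_right]

/-- An element of `M₂₄` which fixes five entries of the octad stabilizes the octad. -/
theorem mem_octadGroup_of_fix {σ : Perm (Fin 24)} (hσ : σ ∈ M24)
    (h : ∀ j : Fin 8, j < 5 → σ (octadPt j) = octadPt j) : σ ∈ octadGroup := by
  have hB : ∀ k : Fin 24, (12861748 : ℕ).testBit k = true ↔ ∃ i, k = octadPt i := by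
    decide +kernel
  refine mem_octadGroup_of_octadPt hσ fun i => ?_
  rw [← hB, testBit_apply_of_fix (s := {5, 8, 23, 14, 2}) hσ (by decide +kernel)
    (by decide +kernel) (by decide) _ _]
  · exact (hB _).2 ⟨i, rfl⟩
  · have h5 : ∀ k ∈ ({5, 8, 23, 14, 2} : Finset (Fin 24)), ∃ j : Fin 8, j < 5 ∧ k = octadPt j := by
      decide
    intro k hk
    obtain ⟨j, hj, rfl⟩ := h5 k hk
    exact ⟨(hB _).2 ⟨j, rfl⟩, h j hj⟩

/-- The stabilizer of the octad and an element of `M₂₄` which fixes four entries of the octad, but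
does not stabilize it, generate `M₂₄`. -/
theorem eq_M24_of_octadGroup_le {H : Subgroup (Perm (Fin 24))} (hle : H ≤ M24)
    (hH : octadGroup ≤ H) {s : Perm (Fin 24)} (hs : s ∈ H)
    (hfix : ∀ j : Fin 8, j < 4 → s (octadPt j) = octadPt j)
    {m : Fin 8} {v : AffineLabel} (hm : s (octadPt m) = affinePt v) : H = M24 := by
  have hoct : ∀ n i : Fin 8, n ≤ 4 → n ≤ i →
      ∃ h ∈ H, (∀ j < n, h (octadPt j) = octadPt j) ∧ h (octadPt i) = octadPt n := by
    intro n i hn hi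
    obtain ⟨α, hα, h1, h2⟩ := exists_even_perm n i hn hi
    obtain ⟨g, hg, h⟩ := exists_octadGroup_of_even hα
    exact ⟨g, hH hg, fun j hj => by rw [h, h1 j hj], by rw [h, h2]⟩
  have hm4 : 4 ≤ m := by
    by_contra! h
    exact affinePt_ne_octadPt v m (hm.symm.trans (hfix m h))
  have hmove : ∀ (n : Fin 8) (y : Fin 24), n ≤ 4 → (∀ j < n, y ≠ octadPt j) →
      ∃ h ∈ H, (∀ j < n, h (octadPt j) = octadPt j) ∧ h y = octadPt n := by
    intro n y hn hy
    rcases eq_octadPt_or_eq_affinePt y with ⟨i, rfl⟩ | hy'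
    · exact hoct n i hn (not_lt.1 fun h => hy i h rfl)
    · obtain ⟨h, hh, h1, h2⟩ := hoct n m hn (hn.trans hm4)
      -- The translation takes `y` to `s (octadPt m)`, then `s⁻¹` brings it into the octad, and `h`
      -- carries it to `octadPt n`. All three factors fix the first `n` octad entries.
      refine ⟨h * (s⁻¹ * translate (v - affineCoord y)), H.mul_mem hh (H.mul_mem (H.inv_mem hs)
        (hH (translate_mem_octadGroup _))), fun j hj => ?_, ?_⟩
      · rw [Perm.mul_apply, Perm.mul_apply, translate_octadPt,
          Perm.inv_eq_iff_eq.2 (hfix j (hj.trans_le hn)).symm, h1 j hj]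
      · have : translate (v - affineCoord y) y = s (octadPt m) := by
          conv_lhs => rw [← hy']
          rw [hm, affineCoord_affinePt]
          exact (translateFun_affinePt _ _).trans (by rw [add_sub_cancel])
        rw [Perm.mul_apply, Perm.mul_apply, this,
          Perm.inv_eq_iff_eq.2 (rfl : s (octadPt m) = s (octadPt m)), h2]
  -- Induction on the number `d` of octad entries still to be fixed among the first five.
  have hmain : ∀ d n : ℕ, n + d = 5 → ∀ τ ∈ M24,
      (∀ j : Fin 8, j.val < n → τ (octadPt j) = octadPt j) → τ ∈ H := by
    intro d
    induction d with
    | zero =>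
      rintro n rfl τ hτ h
      exact hH (mem_octadGroup_of_fix hτ h)
    | succ d ih =>
      intro n hn τ hτ h
      obtain ⟨g, hg, h1, h2⟩ := hmove ⟨n, by omega⟩ (τ (octadPt ⟨n, by omega⟩))
        (Fin.le_def.2 (show n ≤ 4 by omega)) fun j hj hj' => by
          rw [← h j hj] at hj'
          exact hj.ne' (octadPt_injective (τ.injective hj'))
      have h3 : g * τ ∈ H := by
        refine ih (n + 1) (by omega) _ (M24.mul_mem (hle hg) hτ) fun j hj => ?_
        rw [Perm.mul_apply]
        rcases Nat.lt_succ_iff_lt_or_eq.1 hj with hj | rfl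
        · rw [h j hj, h1 j hj]
        · exact h2
      exact (H.mul_mem_cancel_left hg).1 h3
  exact le_antisymm hle fun τ hτ => hmain 5 0 rfl τ hτ fun j hj => absurd hj (Nat.not_lt_zero _)

/-! ### Translations by fixed points -/

theorem mem_torusLattice (m n p q : ℤ) : ((m + n * xi : ℂ), (p + q * xi : ℂ)) ∈ torusLattice := by
  have h1 : ((1 : ℂ), (0 : ℂ)) ∈ torusLattice := AddSubgroup.subset_closure (by simp)
  have h2 : (xi, (0 : ℂ)) ∈ torusLattice := AddSubgroup.subset_closure (by simp)
  have h3 : ((0 : ℂ), (1 : ℂ)) ∈ torusLattice := AddSubgroup.subset_closure (by simp)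
  have h4 : ((0 : ℂ), xi) ∈ torusLattice := AddSubgroup.subset_closure (by simp)
  have := torusLattice.add_mem
    (torusLattice.add_mem (torusLattice.zsmul_mem h1 m) (torusLattice.zsmul_mem h2 n))
    (torusLattice.add_mem (torusLattice.zsmul_mem h3 p) (torusLattice.zsmul_mem h4 q))
  simpa using this

/-- The fixed point of the torus labelled by `t`. -/
noncomputable def torusFixedPt (t : Label) : Torus := (fixedPt t : Torus)

theorem torusFixedPt_add (s t : Label) :
    torusFixedPt (s + t) = torusFixedPt s + torusFixedPt t := by
  have hval : ∀ a b : ZMod 3, ∃ k : ℤ, (a.val + b.val : ℂ) = (a + b).val + 3 * k := fun a b => by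
    refine ⟨((a.val + b.val) / 3 : ℕ), ?_⟩
    have h := congrArg (Nat.cast (R := ℂ)) (Nat.mod_add_div (a.val + b.val) 3)
    rw [Nat.cast_add, Nat.cast_mul, Nat.cast_ofNat] at h
    rw [ZMod.val_add, Int.cast_natCast, ← Nat.cast_add]
    exact h.symm
  obtain ⟨k, hk⟩ := hval s.1 t.1
  obtain ⟨l, hl⟩ := hval s.2 t.2
  refine (QuotientAddGroup.eq (s := torusLattice)).2 ?_
  -- A carry `3k` in the labels contributes `3k (ξ+2)/3 = 2k + kξ`, a lattice element.
  convert mem_torusLattice (2 * k) k (2 * l) l using 1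
  ext1
  · simp only [fixedPt, Prod.fst_add, Prod.fst_neg]
    push_cast
    linear_combination ((xi + 2) / 3) * hk
  · simp only [fixedPt, Prod.snd_add, Prod.snd_neg]
    push_cast
    linear_combination ((xi + 2) / 3) * hl

theorem torusFixedPt_zero : torusFixedPt 0 = 0 := by
  have := torusFixedPt_add 0 0
  rwa [add_zero, left_eq_add] at this

theorem rotTorus_add (p q : Torus) : rotTorus (p + q) = rotTorus p + rotTorus q :=
  map_add (QuotientAddGroup.congr torusLattice torusLattice rotC2 rotC2_map_torusLattice) p q

theorem rotTorus_torusFixedPt (t : Label) : rotTorus (torusFixedPt t) = torusFixedPt t := by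
  refine (QuotientAddGroup.eq (s := torusLattice)).2 ?_
  change -rotC2 (fixedPt t) + fixedPt t ∈ torusLattice
  -- The coefficients come from `(1-ξ)(ξ+2)/3 = 1` and `(1-ξ⁻¹)(ξ+2)/3 = 1+ξ`.
  convert mem_torusLattice t.1.val 0 t.2.val t.2.val using 1
  ext1
  · simp only [fixedPt, rotC2_apply, Prod.fst_add, Prod.fst_neg]
    push_cast
    linear_combination -(t.1.val / 3 : ℂ) * xi_sq
  · simp only [fixedPt, rotC2_apply, Prod.snd_add, Prod.snd_neg, xi_inv]
    push_cast
    linear_combination (t.2.val / 3 : ℂ) * xi_sq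

/-- The translation of the torus by a fixed point. -/
noncomputable def torusShift (u : Label) : Perm Torus := Equiv.addRight (torusFixedPt u)

theorem torusShift_apply (u : Label) (q : Torus) : torusShift u q = q + torusFixedPt u := rfl

/-- Translation by a fixed point commutes with the rotation. -/
theorem sameCycle_torusShift (u : Label) {p q : Torus} (h : rotTorus.SameCycle p q) :
    rotTorus.SameCycle (torusShift u p) (torusShift u q) := by
  have hconj : torusShift u * rotTorus * (torusShift u)⁻¹ = rotTorus := by
    rw [mul_inv_eq_iff_eq_mul]
    ext1 q
    simp only [Perm.mul_apply, torusShift_apply, rotTorus_add, rotTorus_torusFixedPt]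
  rw [← hconj, Perm.sameCycle_conj, Perm.inv_eq_iff_eq.2 rfl, Perm.inv_eq_iff_eq.2 rfl]
  exact h

/-- The translation of `T / ℤ₃` by a fixed point. -/
noncomputable def quotientShift (u : Label) : TorusModZ3 → TorusModZ3 :=
  Quotient.map' (s₁ := Perm.SameCycle.setoid rotTorus) (s₂ := Perm.SameCycle.setoid rotTorus)
    (torusShift u) fun _ _ => sameCycle_torusShift u

theorem quotientShift_proj (u : Label) (z : ℂ × ℂ) :
    quotientShift u (proj z) = proj (z + fixedPt u) := rfl

theorem quotientShift_proj_fixedPt_add (u t : Label) (z : ℂ × ℂ) :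
    quotientShift u (proj (fixedPt t + z)) = proj (fixedPt (t + u) + z) := by
  have h : ((fixedPt t + z + fixedPt u : ℂ × ℂ) : Torus) = (fixedPt (t + u) + z : ℂ × ℂ) := by
    rw [QuotientAddGroup.mk_add, QuotientAddGroup.mk_add, QuotientAddGroup.mk_add, add_right_comm]
    exact congrArg (· + (z : Torus)) (torusFixedPt_add t u).symm
  exact congrArg (Quotient.mk (Perm.SameCycle.setoid rotTorus)) h

theorem quotientShift_add (u w : Label) (p : TorusModZ3) :
    quotientShift u (quotientShift w p) = quotientShift (w + u) p := by
  induction p using Quotient.inductionOn with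
  | h q =>
    refine congrArg (Quotient.mk (Perm.SameCycle.setoid rotTorus)) ?_
    rw [torusShift_apply, torusShift_apply, torusShift_apply, torusFixedPt_add, add_assoc]

theorem quotientShift_zero (p : TorusModZ3) : quotientShift 0 p = p := by
  induction p using Quotient.inductionOn with
  | h q =>
    refine congrArg (Quotient.mk (Perm.SameCycle.setoid rotTorus)) ?_
    rw [torusShift_apply, torusFixedPt_zero, add_zero]

theorem IsSingular.quotientShift {p : TorusModZ3} (h : IsSingular p) (u : Label) :
    IsSingular (quotientShift u p) := by
  obtain ⟨q, hq, rfl⟩ := h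
  exact ⟨torusShift u q, by rw [torusShift_apply, rotTorus_add, hq, rotTorus_torusFixedPt], rfl⟩

theorem not_isSingular_quotientShift {p : TorusModZ3} (h : ¬ IsSingular p) (u : Label) :
    ¬ IsSingular (quotientShift u p) := fun h' => h <| by
  have := h'.quotientShift (-u)
  rwa [quotientShift_add, add_neg_cancel, quotientShift_zero] at this

/-- The self-map of `X` induced by the translation by a fixed point. -/
noncomputable def surfaceShiftFun (u : Label) : Surface → Surface
  | .reg p hp => .reg (quotientShift u p) (not_isSingular_quotientShift hp u)
  | .exc t v hv => .exc (t + u) v hv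

theorem surfaceShiftFun_add (u w : Label) (P : Surface) :
    surfaceShiftFun u (surfaceShiftFun w P) = surfaceShiftFun (w + u) P := by
  cases P with
  | reg p hp => simp only [surfaceShiftFun, quotientShift_add]
  | exc t v hv => simp only [surfaceShiftFun, add_assoc]

theorem surfaceShiftFun_zero (P : Surface) : surfaceShiftFun 0 P = P := by
  cases P with
  | reg p hp => simp only [surfaceShiftFun, quotientShift_zero]
  | exc t v hv => simp only [surfaceShiftFun, add_zero]

/-- The automorphism of `X` induced by the translation by a fixed point. -/
noncomputable def surfaceShift (u : Label) : Perm Surface where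
  toFun := surfaceShiftFun u
  invFun := surfaceShiftFun (-u)
  left_inv P := by rw [surfaceShiftFun_add, add_neg_cancel, surfaceShiftFun_zero]
  right_inv P := by rw [surfaceShiftFun_add, neg_add_cancel, surfaceShiftFun_zero]

theorem hasCoord_flat_surfaceShiftFun (u : Label) {z : ℂ × ℂ} {P : Surface}
    (h : HasCoord .flat z P) : HasCoord .flat (z + fixedPt u) (surfaceShiftFun u P) := by
  cases P with
  | reg p hp =>
    obtain rfl : p = proj z := h
    exact quotientShift_proj u z
  | exc t v hv => exact h.elim

theorem hasCoord_blowUp_surfaceShiftFun (u : Label) {t : Label} {j : Fin 3} {a : ℂ × ℂ}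
    {P : Surface} (h : HasCoord (.blowUp t j) a P) :
    HasCoord (.blowUp (t + u) j) a (surfaceShiftFun u P) := by
  cases P with
  | reg p hp =>
    obtain ⟨h1, z, hz, rfl⟩ := h
    exact ⟨h1, z, hz, quotientShift_proj_fixedPt_add u t z⟩
  | exc s v hv =>
    obtain ⟨h1, rfl, h2⟩ := h
    exact ⟨h1, rfl, h2⟩

/-- In the flat chart the map is a translation; between the blow-up charts at `t` and `t + u` it is
the identity. -/
theorem isHolomorphic_surfaceShiftFun (u : Label) : IsHolomorphic (surfaceShiftFun u) := by
  rintro (_ | ⟨t, j⟩) a P -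
  · exact ⟨.flat, fun z => z + fixedPt u, analyticAt_id.add analyticAt_const,
      Filter.Eventually.of_forall fun _ _ => hasCoord_flat_surfaceShiftFun u⟩
  · exact ⟨.blowUp (t + u) j, id, analyticAt_id,
      Filter.Eventually.of_forall fun _ _ => hasCoord_blowUp_surfaceShiftFun u⟩

theorem preservesForms_surfaceShiftFun (u : Label) : PreservesForms (surfaceShiftFun u) := by
  intro z _
  refine ⟨fun z => z + fixedPt u, analyticAt_id.add analyticAt_const,
    Filter.Eventually.of_forall fun _ _ => hasCoord_flat_surfaceShiftFun u, fun v w => ?_⟩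
  rw [fderiv_add_const, fderiv_fun_id]
  exact ⟨rfl, rfl⟩

theorem surfaceShift_mem_symmetryGroup (u : Label) : surfaceShift u ∈ symmetryGroup :=
  ⟨⟨isHolomorphic_surfaceShiftFun u, isHolomorphic_surfaceShiftFun (-u)⟩,
    preservesForms_surfaceShiftFun u, preservesForms_surfaceShiftFun (-u)⟩

theorem surfaceShiftFun_mem_excCurve (u t : Label) (k : Fin 2) {P : Surface}
    (h : P ∈ excCurve t k) : surfaceShiftFun u P ∈ excCurve (t + u) k := by
  obtain ⟨v, hv, rfl, hk⟩ := h
  exact ⟨v, hv, rfl, hk⟩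

theorem image_surfaceShift_excCurve (u t : Label) (k : Fin 2) :
    surfaceShift u '' excCurve t k = excCurve (t + u) k := by
  apply subset_antisymm
  · rintro _ ⟨P, hP, rfl⟩
    exact surfaceShiftFun_mem_excCurve u t k hP
  · intro P hP
    have := surfaceShiftFun_mem_excCurve (-u) (t + u) k hP
    rw [add_neg_cancel_right] at this
    exact ⟨_, this, (surfaceShift u).apply_symm_apply P⟩

/-! ### Automorphisms of the Niemeier lattice which permute the components -/

/-- The linear map which permutes the components `A_{2,j}`. -/
def permComponents (π : Perm (Fin 12)) : RootSpace ≃ₗ[ℚ] RootSpace :=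
  LinearEquiv.funCongrLeft ℚ (Fin 2 → ℚ) π.symm

theorem permComponents_apply (π : Perm (Fin 12)) (v : RootSpace) (j : Fin 12) :
    permComponents π v j = v (π.symm j) := rfl

theorem permComponents_simpleRoot (π : Perm (Fin 12)) (j : Fin 12) (l : Fin 2) :
    permComponents π (simpleRoot j l) = simpleRoot (π j) l := by
  funext i
  rw [permComponents_apply, simpleRoot, simpleRoot, Pi.single_apply, Pi.single_apply]
  exact if_congr (Equiv.symm_apply_eq π) rfl rfl

theorem rootForm_permComponents (π : Perm (Fin 12)) (v w : RootSpace) :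
    rootForm (permComponents π v) (permComponents π w) = rootForm v w := by
  simp only [rootForm, permComponents_apply]
  exact Equiv.sum_comp π.symm fun j =>
    2 * v j 0 * w j 0 + 2 * v j 1 * w j 1 - v j 0 * w j 1 - v j 1 * w j 0

theorem inducesPerm_permComponents (π : Perm (Fin 12)) : InducesPerm (permComponents π) π := by
  intro j
  have h := Submodule.map_span ((permComponents π).toLinearMap.restrictScalars ℤ)
    (Set.range (simpleRoot j))
  rw [← Set.range_comp] at h
  have h' := congrArg (fun S : Submodule ℤ RootSpace => (S : Set RootSpace)) h
  refine h'.trans ?_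
  rw [rootComponent]
  congr 3
  funext l
  exact permComponents_simpleRoot π j l

theorem glueVector_apply (i : Fin 6) (j : Fin 12) :
    glueVector i j = ![(ternaryGolay i j : ℚ) / 3, 2 * (ternaryGolay i j : ℚ) / 3] := by
  have h : ∀ l, (∑ k, (ternaryGolay i k : ℚ) • (simpleRoot k 0 + (2 : ℚ) • simpleRoot k 1)) j l =
      (ternaryGolay i j : ℚ) • (simpleRoot j 0 + (2 : ℚ) • simpleRoot j 1) j l := by
    intro l
    rw [Finset.sum_apply, Finset.sum_apply, Finset.sum_eq_single j]
    · rfl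
    · intro k _ hk
      simp [simpleRoot, hk.symm]
    · simp
  funext l
  rw [glueVector, Pi.smul_apply, Pi.smul_apply, h]
  fin_cases l <;> simp [simpleRoot] <;> ring

theorem mem_niemeier_of_int {v : RootSpace} (n : Fin 12 → Fin 2 → ℤ) (h : ∀ j l, v j l = n j l) :
    v ∈ niemeier := by
  have hv : v = ∑ j, ∑ l, n j l • simpleRoot j l := by
    funext j l
    rw [h, Finset.sum_apply, Finset.sum_apply, Finset.sum_eq_single j]
    · fin_cases l <;> simp [simpleRoot]
    · intro k _ hk
      simp [simpleRoot, hk.symm]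
    · simp
  rw [hv]
  exact Submodule.sum_mem _ fun j _ => Submodule.sum_mem _ fun l _ =>
    Submodule.smul_mem _ _ (Submodule.subset_span (Or.inl ⟨(j, l), rfl⟩))

/-- A permutation of the components which preserves the ternary Golay code maps the Niemeier
lattice to itself. The last six entries of a code word are its coefficients. -/
theorem permComponents_mem_niemeier {π : Perm (Fin 12)}
    (h : ∀ i j, (3 : ℤ) ∣ ternaryGolay i (π.symm j) -
      ∑ k : Fin 6, ternaryGolay i (π.symm (Fin.natAdd 6 k)) * ternaryGolay k j)
    {v : RootSpace} (hv : v ∈ niemeier) : permComponents π v ∈ niemeier := by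
  suffices niemeier ≤
      niemeier.comap ((permComponents π).toLinearMap.restrictScalars ℤ) from this hv
  refine Submodule.span_le.2 ?_
  rintro _ (⟨⟨j, l⟩, rfl⟩ | ⟨i, rfl⟩)
  · change permComponents π (simpleRoot j l) ∈ niemeier
    rw [permComponents_simpleRoot]
    exact Submodule.subset_span (Or.inl ⟨(π j, l), rfl⟩)
  · change permComponents π (glueVector i) ∈ niemeier
    choose n hn using fun j => h i j
    have hsum : ∑ k : Fin 6, ternaryGolay i (π.symm (Fin.natAdd 6 k)) • glueVector k ∈ niemeier :=
      Submodule.sum_mem _ fun k _ => Submodule.smul_mem _ _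
        (Submodule.subset_span (Or.inr ⟨k, rfl⟩))
    -- The permuted glue vector and the combination of glue vectors differ at `j` by `3 n j · (1/3,
    -- 2/3)`, which is integral.
    refine (Submodule.sub_mem_iff_left _ hsum).1
      (mem_niemeier_of_int (fun j => ![n j, 2 * n j]) fun j l => ?_)
    have hq : (ternaryGolay i (π.symm j) : ℚ) - ∑ k : Fin 6,
        (ternaryGolay i (π.symm (Fin.natAdd 6 k)) : ℚ) * ternaryGolay k j = 3 * n j := by
      exact_mod_cast hn j
    have hs : (∑ k : Fin 6, ternaryGolay i (π.symm (Fin.natAdd 6 k)) • glueVector k) j l =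
        (∑ k : Fin 6, (ternaryGolay i (π.symm (Fin.natAdd 6 k)) : ℚ) * ternaryGolay k j) *
          (![1 / 3, 2 / 3] : Fin 2 → ℚ) l := by
      rw [Finset.sum_apply, Finset.sum_apply, Finset.sum_mul]
      refine Finset.sum_congr rfl fun k _ => ?_
      rw [Pi.smul_apply, Pi.smul_apply, glueVector_apply, zsmul_eq_mul]
      fin_cases l <;> simp <;> ring
    rw [Pi.sub_apply, Pi.sub_apply, hs, permComponents_apply, glueVector_apply]
    generalize ∑ k : Fin 6, (ternaryGolay i (π.symm (Fin.natAdd 6 k)) : ℚ) * ternaryGolay k j = S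
      at hq
    fin_cases l
    · simp
      linear_combination hq / 3
    · simp
      linear_combination 2 * hq / 3

/-- The permutation of the components induced by the translation by the fixed point with
label `(0, 1)`. -/
def shiftPerm : Perm (Fin 12) where
  -- Three 3-cycles realise `t ↦ t + (0, 1)` on the nine components used by `iota`; the components
  -- 9, 10, 11 stay fixed.
  toFun := ![8, 4, 1, 6, 2, 3, 5, 0, 7, 9, 10, 11]
  invFun := ![7, 2, 4, 5, 1, 6, 3, 8, 0, 9, 10, 11]
  left_inv := by unfold Function.LeftInverse; decide
  right_inv := by unfold Function.RightInverse Function.LeftInverse; decide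

/-- The generating matrix of the extended ternary Golay code as a function of two arguments. -/
def ternaryEntry (i : Fin 6) (j : Fin 12) : ℤ := ternaryGolay i j

theorem isNiemeierAut_permComponents_shiftPerm : IsNiemeierAut (permComponents shiftPerm) := by
  have h1 : ∀ i j, (3 : ℤ) ∣ ternaryEntry i (shiftPerm.symm j) -
      ∑ k : Fin 6, ternaryEntry i (shiftPerm.symm (Fin.natAdd 6 k)) * ternaryEntry k j := by
    decide +kernel
  have h2 : ∀ i j, (3 : ℤ) ∣ ternaryEntry i (shiftPerm.symm.symm j) -
      ∑ k : Fin 6, ternaryEntry i (shiftPerm.symm.symm (Fin.natAdd 6 k)) * ternaryEntry k j := by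
    decide +kernel
  refine ⟨rootForm_permComponents _, fun v => ⟨fun hv => ?_, permComponents_mem_niemeier h1⟩⟩
  have h := permComponents_mem_niemeier h2 hv
  rwa [show permComponents shiftPerm.symm (permComponents shiftPerm v) = v from
    (permComponents shiftPerm).symm_apply_apply v] at h

/-- The sign in `iota` depends only on the first coordinate of the label, which this shift
preserves, so no sign changes are needed. -/
theorem extends_surfaceShift : Extends (surfaceShift (0, 1)) (permComponents shiftPerm) := by
  intro t k
  refine ⟨t + (0, 1), k, image_surfaceShift_excCurve _ t k, ?_⟩
  have h : ∀ t : Label, (iotaData t).1 = (iotaData (t + (0, 1))).1 ∧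
      shiftPerm (iotaData t).2 = (iotaData (t + (0, 1))).2 := by decide +kernel
  rw [iota, iota, map_smul, permComponents_simpleRoot, (h t).1, (h t).2]

/-- The element of `M₂₄` assigned to the translation by the fixed point with label `(0, 1)`. -/
def shiftTheta : Perm (Fin 24) where
  -- On the dodecad the values are dictated by `shiftPerm`; the others complete them to a
  -- permutation preserving the code.
  toFun := ![22, 17, 15, 3, 13, 5, 14, 1, 8, 19, 10, 0, 2, 21, 18, 12, 16, 7, 6, 20, 9, 4, 11, 23]
  invFun := ![11, 7, 12, 3, 21, 5, 18, 17, 8, 20, 10, 22, 15, 4, 6, 2, 16, 1, 14, 9, 19, 13, 0, 23]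
  left_inv := by unfold Function.LeftInverse; decide
  right_inv := by unfold Function.RightInverse Function.LeftInverse; decide

theorem shiftTheta_mem_M24 : shiftTheta ∈ M24 :=
  mem_M24_of_preservesGolay (by decide +kernel)

theorem shiftTheta_mem_thetaImage : shiftTheta ∈ thetaImage :=
  ⟨surfaceShift (0, 1), surfaceShift_mem_symmetryGroup _, permComponents shiftPerm, shiftPerm,
    isNiemeierAut_permComponents_shiftPerm, extends_surfaceShift, inducesPerm_permComponents _,
    shiftTheta_mem_M24, by decide +kernel⟩

theorem octadGroup_sup_closure_thetaImage : octadGroup ⊔ Subgroup.closure thetaImage = M24 := by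
  -- `shiftTheta` fixes `octadPt` 0, 1, 2 and sends `octadPt 3` to `octadPt 6`. The correction `g`
  -- keeps the first three and moves `octadPt 6` back to `octadPt 3`.
  obtain ⟨α, hα, h1, h2⟩ := exists_even_perm 3 6 (by decide) (by decide)
  obtain ⟨g, hg, hgα⟩ := exists_octadGroup_of_even hα
  have hle : octadGroup ⊔ Subgroup.closure thetaImage ≤ M24 := by
    refine sup_le (fun σ hσ => hσ.1) ((Subgroup.closure_le _).2 ?_)
    rintro σ ⟨f, -, Φ, π, -, -, -, hσ, -⟩
    exact hσ
  have hs : g * shiftTheta ∈ octadGroup ⊔ Subgroup.closure thetaImage :=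
    Subgroup.mul_mem _ (Subgroup.mem_sup_left hg)
      (Subgroup.mem_sup_right (Subgroup.subset_closure shiftTheta_mem_thetaImage))
  have hfix : ∀ j : Fin 8, j < 3 → shiftTheta (octadPt j) = octadPt j := by decide +kernel
  -- The entry 15 is the image of `octadPt 4` under `shiftTheta`. It lies outside the octad, and `g`
  -- keeps it outside.
  have h15 : ∃ v, g 15 = affinePt v := by
    rcases eq_octadPt_or_eq_affinePt (g 15) with ⟨i, hi⟩ | h
    · have hmem := (apply_mem_octad_iff ⟨g, hg⟩ 15).1
        (by rw [octad_eq_range]; exact ⟨i, hi.symm⟩)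
      rw [octad_eq_range] at hmem
      exact absurd hmem (by decide +kernel)
    · exact ⟨_, h.symm⟩
  obtain ⟨v, hv⟩ := h15
  refine eq_M24_of_octadGroup_le hle le_sup_left hs (fun j hj => ?_) (m := 4) (v := v) ?_
  · rw [Perm.mul_apply]
    by_cases h3 : j < 3
    · rw [hfix j h3, hgα, h1 j h3]
    · obtain rfl : j = 3 := by omega
      rw [show shiftTheta (octadPt 3) = octadPt 6 by decide +kernel, hgα, h2]
  · rw [Perm.mul_apply, show shiftTheta (octadPt 4) = 15 by decide +kernel, hv]

end Z3OrbifoldK3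

theorem theorem3p10 :
    (∃ φ : alternatingGroup (Fin 8) →* MulAut (Multiplicative (Fin 4 → ZMod 2)),
      Nonempty (Z3OrbifoldK3.octadGroup ≃*
        SemidirectProduct (Multiplicative (Fin 4 → ZMod 2)) (alternatingGroup (Fin 8)) φ)) ∧
    Z3OrbifoldK3.octadGroup ⊔ Subgroup.closure Z3OrbifoldK3.thetaImage = Z3OrbifoldK3.M24 :=
  ⟨Z3OrbifoldK3.exists_octadGroup_mulEquiv, Z3OrbifoldK3.octadGroup_sup_closure_thetaImage⟩
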